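/- Let $X$ be a finite metric graph, that is, the geometric realization of a finite connected simplicial complex of dimension at most $1$ (a finite connected simple graph) with the length metric for which every edge has length $1$. Let $\varepsilon>0$, let $\bar B(x,\varepsilon)$ denote the closed ball, let $p_\varepsilon(X)=\{\bar B(x,\varepsilon):x\in X\}$ carry the Hausdorff metric, and write $x\sim_\varepsilon y$ if $\bar B(x,\varepsilon)=\bar B(y,\varepsilon)$. Write $\varepsilon=\frac k2+\varepsilon_0$ with $k\in\mathbb Z$, $0\le\varepsilon_0<\frac12$, and let $X_\varepsilon$ be the subdivision of $X$ obtained by cutting every edge, identified with $[0,1]$, at the points $\varepsilon_0,\ \frac12-\varepsilon_0,\ \frac12,\ \frac12+\varepsilon_0,\ 1-\varepsilon_0$ (so into $2$ parts if $\varepsilon_0=0$, into $4$ parts if $\varepsilon_0=\frac14$, and into $6$ parts otherwise). As a metric space $X_\varepsilon$ is $X$. Edges of $X_\varepsilon$ are taken to be open unless stated otherwise. Then $[x]\mapsto\bar B(x,\varepsilon)$ is a homeomorphism $X_\varepsilon/{\sim_\varepsilon}\to p_\varepsilon(X)$, and $X_\varepsilon/{\sim_\varepsilon}$ is (topologically)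 a finite connected graph, possibly a single point. More precisely, it has a finite graph structure (loops and multiple edges allowed) whose vertices are the classes of the vertices of $X_\varepsilon$ and whose open edges are the images of the open edges of $X_\varepsilon$ that contain a point $x$ with $\bar B(x,\varepsilon)\ne X$. Moreover: (a) If $x$ lies in an open edge $e$ of $X_\varepsilon$ and $\bar B(x,\varepsilon)\ne X$, then for every $x'\neq x$ we have $x'\sim_\varepsilon x$ if and only if there are an open edge $e'\ne e$ of $X_\varepsilon$ and an isometry $h$ of $e$ onto $e'$ with $h(y)\sim_\varepsilon y$ for all $y\in e$ (so $e$ and $e'$ are identified in the quotient) such that $x'=h(x)$. (b) If $v$ is a vertex of $X_\varepsilon$ with $\bar B(v,\varepsilon)\neq X$, then every $x'$ with $x'\sim_\varepsilon v$ is a vertex of $X_\varepsilon$. (c) If an open edge $e$ of $X_\varepsilon$ contains a point $x$ with $\bar B(x,\varepsilon)=X$, then $\bar B(y,\varepsilon)=X$ for every $y$ in the closure of $e$, and the image of the closed edge in $X_\varepsilon/{\sim_\varepsilon}$ is a single point, the class of a vertex of $X_\varepsilon$. -/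

import Mathlib

open Set Metric

noncomputable section

namespace FiniteMetricGraph

variable {V : Type*} [Fintype V]

/-- The geometric realization of the finite simple graph `G`, regarded as a simplicial complex of
dimension at most one: a point is a family of barycentric coordinates supported on a vertex
(`u = v`) or on an edge (`G.Adj u v`). -/
@[ext]
structure Realization (G : SimpleGraph V) where
  coord : V → ℝ
  nonneg : ∀ v, 0 ≤ coord v
  sum_eq_one : ∑ v, coord v = 1
  face : ∃ u v, (u = v ∨ G.Adj u v) ∧ ∀ w, w ≠ u → w ≠ v → coord w = 0

variable {G : SimpleGraph V}

/-- `x` and `y` lie in a common closed edge (or are the same vertex). -/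
def OnCommonEdge (x y : Realization G) : Prop :=
  ∃ u v, (u = v ∨ G.Adj u v) ∧ ∀ w, w ≠ u → w ≠ v → x.coord w = 0 ∧ y.coord w = 0

theorem OnCommonEdge.symm {x y : Realization G} (h : OnCommonEdge x y) : OnCommonEdge y x := by
  obtain ⟨u, v, h, h'⟩ := h
  exact ⟨u, v, h, fun w h1 h2 => (h' w h1 h2).symm⟩

/-- `IsPathLength x y l`: there is a polygonal path `x = x₀, x₁, …, xₙ = y` of total length `l`,
each piece `[xᵢ, xᵢ₊₁]` being a segment of a closed edge. On a closed edge the sup distance of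
the coordinate vectors is the difference of the parameters, so that every edge has length one. -/
inductive IsPathLength : Realization G → Realization G → ℝ → Prop
  | refl (x : Realization G) : IsPathLength x x 0
  | cons (x y z : Realization G) (l : ℝ) (h : OnCommonEdge x y) (hl : IsPathLength y z l) :
      IsPathLength x z (dist x.coord y.coord + l)

theorem IsPathLength.le {x y : Realization G} {l : ℝ} (h : IsPathLength x y l) :
    dist x.coord y.coord ≤ l := by
  induction h with
  | refl x => simp
  | cons x y z l h hl ih => exact (dist_triangle _ y.coord _).trans (by gcongr)

theorem IsPathLength.trans {x y z : Realization G} {l m : ℝ} (h : IsPathLength x y l)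
    (h' : IsPathLength y z m) : IsPathLength x z (l + m) := by
  induction h with
  | refl x => simpa using h'
  | cons x y w l h hl ih =>
    rw [add_assoc]
    exact .cons _ _ _ _ h (ih h')

theorem OnCommonEdge.isPathLength {x y : Realization G} (h : OnCommonEdge x y) :
    IsPathLength x y (dist x.coord y.coord) := by
  simpa using IsPathLength.cons x y y 0 h (.refl y)

theorem IsPathLength.symm {x y : Realization G} {l : ℝ} (h : IsPathLength x y l) :
    IsPathLength y x l := by
  induction h with
  | refl x => exact .refl x
  | cons x y z l h hl ih =>
    rw [add_comm, dist_comm]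
    exact ih.trans h.symm.isPathLength

open Classical in
/-- The point of the realization given by a vertex of `G`. -/
def vertexPt (G : SimpleGraph V) (v : V) : Realization G where
  coord := Pi.single v 1
  nonneg w := by by_cases h : w = v <;> simp [h]
  sum_eq_one := by simp
  face := ⟨v, v, Or.inl rfl, fun w h _ => by simp [h]⟩

theorem exists_isPathLength (hG : G.Connected) (x y : Realization G) :
    ∃ l, IsPathLength x y l := by
  have key : ∀ x : Realization G, ∃ v l, IsPathLength x (vertexPt G v) l := by
    intro x
    obtain ⟨u, v, h, h'⟩ := x.face
    exact ⟨u, _, OnCommonEdge.isPathLength ⟨u, v, h, fun w h1 h2 =>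
      ⟨h' w h1 h2, by simp [vertexPt, h1]⟩⟩⟩
  have walk : ∀ u v : V, G.Walk u v → ∃ l, IsPathLength (vertexPt G u) (vertexPt G v) l := by
    intro u v p
    induction p with
    | nil => exact ⟨_, .refl _⟩
    | cons h p ih =>
      obtain ⟨l, hl⟩ := ih
      exact ⟨_, .cons _ _ _ _ ⟨_, _, Or.inr h, fun w h1 h2 => by simp [vertexPt, h1, h2]⟩ hl⟩
  obtain ⟨u, l, hu⟩ := key x
  obtain ⟨v, m, hv⟩ := key y
  obtain ⟨k, hk⟩ := walk u v (hG.preconnected u v).some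
  exact ⟨_, (hu.trans hk).trans hv.symm⟩

/-- The length distance on the realization: the infimum of the lengths of the polygonal paths. -/
def lengthDist (x y : Realization G) : ℝ := sInf {l | IsPathLength x y l}

theorem bddBelow_lengths (x y : Realization G) : BddBelow {l | IsPathLength x y l} :=
  ⟨0, fun _ hl => dist_nonneg.trans hl.le⟩

/-- The finite metric graph: the realization of a finite connected graph with the length metric
for which every edge has length one. -/
instance [hG : Fact G.Connected] : MetricSpace (Realization G) where
  dist := lengthDist
  dist_self x := le_antisymm (csInf_le (bddBelow_lengths x x) (.refl x))
    (le_csInf ⟨0, .refl x⟩ fun _ hl => dist_nonneg.trans hl.le)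
  dist_comm x y := by
    have : {l | IsPathLength x y l} = {l | IsPathLength y x l} :=
      Set.ext fun l => ⟨.symm, .symm⟩
    simp only [lengthDist, this]
  dist_triangle x y z := by
    have h1 : lengthDist x z - lengthDist y z ≤ lengthDist x y := by
      refine le_csInf (exists_isPathLength hG.out x y) fun l hl => ?_
      have h2 : lengthDist x z - l ≤ lengthDist y z := by
        refine le_csInf (exists_isPathLength hG.out y z) fun m hm => ?_
        have : lengthDist x z ≤ l + m := csInf_le (bddBelow_lengths x z) (hl.trans hm)
        linarith
      linarith
    linarith
  eq_of_dist_eq_zero {x y} h := by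
    have h1 : dist x.coord y.coord ≤ lengthDist x y :=
      le_csInf (exists_isPathLength hG.out x y) fun l hl => hl.le
    exact Realization.ext (dist_le_zero.1 (h1.trans h.le))

theorem dist_le_of_onCommonEdge [Fact G.Connected] {x y : Realization G}
    (h : OnCommonEdge x y) : dist x y ≤ dist x.coord y.coord :=
  csInf_le (bddBelow_lengths x y) h.isPathLength

open Classical in
/-- The point of the edge `uv` with coordinate `t` at `u` and `1 - t` at `v`. -/
def edgePt (u v : V) (h : G.Adj u v) (t : unitInterval) : Realization G where
  coord := Pi.single u (t : ℝ) + Pi.single v (1 - (t : ℝ))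
  nonneg w := by
    have h0 := t.2.1
    have h1 := t.2.2
    simp only [Pi.add_apply, Pi.single_apply]
    split_ifs <;> linarith
  sum_eq_one := by simp [Finset.sum_add_distrib]
  face := ⟨u, v, Or.inr h, fun w h1 h2 => by simp [h1, h2]⟩

theorem continuous_edgePt [Fact G.Connected] (u v : V) (h : G.Adj u v) :
    Continuous (edgePt u v h) := by
  refine (LipschitzWith.of_dist_le_mul (K := 1) fun s t => ?_).continuous
  refine (dist_le_of_onCommonEdge ⟨u, v, Or.inr h, fun w h1 h2 => by
    simp [edgePt, h1, h2]⟩).trans ?_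
  rw [dist_pi_le_iff (by positivity)]
  intro w
  have huv := h.ne
  simp only [edgePt, Pi.add_apply, Pi.single_apply, NNReal.coe_one, one_mul, Subtype.dist_eq,
    Real.dist_eq]
  by_cases h1 : w = u
  · subst h1
    simp [huv]
  · by_cases h2 : w = v
    · subst h2
      simp [h1, abs_sub_comm]
    · simp [h1, h2]

theorem eq_edgePt {u v : V} (h : G.Adj u v) (x : Realization G)
    (hx : ∀ w, w ≠ u → w ≠ v → x.coord w = 0) : ∃ t, edgePt u v h t = x := by
  classical
  have hs : x.coord u + x.coord v = 1 := by
    rw [← x.sum_eq_one, ← Finset.sum_pair h.ne]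
    refine Finset.sum_subset (Finset.subset_univ _) fun w _ hw => ?_
    simp only [Finset.mem_insert, Finset.mem_singleton, not_or] at hw
    exact hx w hw.1 hw.2
  refine ⟨⟨x.coord u, x.nonneg u, by linarith [x.nonneg v]⟩, Realization.ext (funext fun w => ?_)⟩
  by_cases h1 : w = u
  · subst h1
    simp [edgePt, h.ne]
  · by_cases h2 : w = v
    · subst h2
      simp [edgePt, h1]
      linarith
    · simp [edgePt, h1, h2, hx w h1 h2]

theorem eq_vertexPt {u : V} (x : Realization G) (hx : ∀ w, w ≠ u → x.coord w = 0) :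
    x = vertexPt G u := by
  have hs : x.coord u = 1 := by
    rw [← x.sum_eq_one]
    exact (Finset.sum_eq_single u (fun w _ h => hx w h) (by simp)).symm
  refine Realization.ext (funext fun w => ?_)
  by_cases h : w = u
  · subst h
    simp [vertexPt, hs]
  · simp [vertexPt, h, hx w h]

instance [Fact G.Connected] : CompactSpace (Realization G) := by
  refine ⟨?_⟩
  have hcov : (univ : Set (Realization G)) = range (vertexPt G) ∪
      ⋃ p : {p : V × V // G.Adj p.1 p.2}, range (edgePt p.1.1 p.1.2 p.2) := by
    refine (eq_univ_of_forall fun x => ?_).symm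
    obtain ⟨u, v, h | h, hx⟩ := x.face
    · subst h
      exact Or.inl ⟨u, (eq_vertexPt x fun w h => hx w h h).symm⟩
    · exact Or.inr (mem_iUnion.2 ⟨⟨(u, v), h⟩, eq_edgePt h x hx⟩)
  rw [hcov]
  exact (finite_range _).isCompact.union
    (isCompact_iUnion fun p => isCompact_range (continuous_edgePt _ _ _))

/-- The map `p_ε` sending a point to its closed `ε`-ball, an element of the hyperspace of
nonempty compact subsets with the Hausdorff metric. -/
def ballMap (G : SimpleGraph V) [Fact G.Connected] (ε : ℝ) (hε : 0 ≤ ε) (x : Realization G) :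
    TopologicalSpace.NonemptyCompacts (Realization G) where
  carrier := closedBall x ε
  isCompact' := isClosed_closedBall.isCompact
  nonempty' := ⟨x, mem_closedBall_self hε⟩

/-- The relation `x ∼_ε y`: the closed `ε`-balls about `x` and `y` coincide. -/
def ballSetoid (G : SimpleGraph V) [Fact G.Connected] (ε : ℝ) : Setoid (Realization G) where
  r x y := closedBall x ε = closedBall y ε
  iseqv := ⟨fun _ => rfl, fun h => h.symm, fun h h' => h.trans h'⟩

/-- The quotient space of the metric graph by `∼_ε`, with the quotient topology. -/
abbrev BallQuotient (G : SimpleGraph V) [Fact G.Connected] (ε : ℝ) : Type _ :=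
  Quotient (ballSetoid G ε)

/-- The quotient map. -/
def toQuot (G : SimpleGraph V) [Fact G.Connected] (ε : ℝ) (x : Realization G) :
    BallQuotient G ε :=
  Quotient.mk (ballSetoid G ε) x

/-- The number `ε₀ ∈ [0, 1/2)` with `ε = k / 2 + ε₀`, `k` an integer. -/
def halfRem (ε : ℝ) : ℝ := ε - (⌊2 * ε⌋ : ℝ) / 2

/-- The positions in `[0, 1]` at which every edge is subdivided (with the two ends). If `ε₀ = 0`
these are `0, 1/2, 1`, if `ε₀ = 1/4` the multiples of `1/4`, and otherwise there are seven of
them: each half edge is cut into pieces of lengths `ε₀, 1/2 - 2 ε₀, ε₀` for `ε₀ < 1/4` and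
`1/2 - ε₀, 2 ε₀ - 1/2, 1/2 - ε₀` for `ε₀ > 1/4`. -/
def cutSet (ε : ℝ) : Set ℝ :=
  {0, halfRem ε, 1 / 2 - halfRem ε, 1 / 2, 1 / 2 + halfRem ε, 1 - halfRem ε, 1}

/-- The vertices of the subdivision `X_ε`, as points of the metric graph. -/
def subdivVertices (G : SimpleGraph V) (ε : ℝ) : Set (Realization G) :=
  {x | ∀ v, x.coord v ∈ cutSet ε}

/-- The open edges of the subdivision `X_ε`: the open segments of the edges `uv` of `G` between
two consecutive cut positions. -/
def subdivEdges (G : SimpleGraph V) (ε : ℝ) : Set (Set (Realization G)) :=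
  {e | ∃ u v a b, G.Adj u v ∧ a ∈ cutSet ε ∧ b ∈ cutSet ε ∧ a < b ∧
    (∀ c ∈ cutSet ε, ¬ (a < c ∧ c < b)) ∧
    e = {x | x.coord u + x.coord v = 1 ∧ a < x.coord u ∧ x.coord u < b}}

/-- `vs` and `es` are the vertices and the open edges of a finite graph structure (a finite cell
structure of dimension at most one; loops and multiple edges are allowed) on `Y`. -/
structure IsGraphStructure {Y : Type*} [TopologicalSpace Y] (vs : Set Y) (es : Set (Set Y)) :
    Prop where
  t2 : T2Space Y
  finite_vertices : vs.Finite
  finite_edges : es.Finite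
  cover : vs ∪ ⋃₀ es = univ
  disjoint_vertices : ∀ e ∈ es, Disjoint vs e
  disjoint_edges : es.PairwiseDisjoint id
  param : ∀ e ∈ es, ∃ γ : ℝ → Y, ContinuousOn γ (Icc 0 1) ∧ γ 0 ∈ vs ∧ γ 1 ∈ vs ∧
    InjOn γ (Ioo 0 1) ∧ γ '' Ioo 0 1 = e

/-- `Y` is, topologically, a finite connected graph: it is homeomorphic to the realization of a
finite connected simplicial complex of dimension at most one. -/
def IsTopGraph (Y : Type*) [TopologicalSpace Y] : Prop :=
  ∃ (n : ℕ) (H : SimpleGraph (Fin n)) (_ : Fact H.Connected), Nonempty (Y ≃ₜ Realization H)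

end FiniteMetricGraph

end

open FiniteMetricGraph

namespace FiniteMetricGraph

variable {V : Type*} [Fintype V] {G : SimpleGraph V}

/-! ### Coordinates -/

/-! The proof rests on how distances vary along half an edge. From a point outside the interior of
an edge `ab`, a point of `ab` is reached through `a` or through `b` (`dist_eq_min`). Hence a point
at distance s ≤ 1/2 from an end of its edge has distance n ± s from any given vertex, with n an
integer (`exists_dist_vertexPt_affine`). A ball centred at x outside the interior of `ab` covers
`ab` exactly when d(x,a) + d(x,b) + 1 ≤ 2ε (`edge_covered_iff`). So "this vertex is reached" and
"this edge is covered" both read N + τs ≤ 2ε with N an integer and τ ∈ {0, 2, -2}. Their truth can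
change only where 2s ≡ ±2ε modulo 1, which is a cut position, so it is constant on each open edge of
X_ε (`IsGap.stable`, `IsGap.edge_stable`).

Now let x lie in an open edge and let x' ≠ x have the same ball, different from X. A point whose
ball misses part of the edge containing it in its interior is determined by the ball
(`eq_of_uncovered_right`), so neither centre is interior to an uncovered edge. On an uncovered edge
with a reached end a, the ball itself shows d(x,a) = d(x',a), and such an edge exists
(`exists_partial_edge`). The equality n + σs = n' + σ's' with 0 < s < 1/2 and 0 ≤ s' ≤ 1/2 forces s
= s', σ = σ' and n = n' (`affine_match`). When both points move by the same amount these distances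
therefore stay equal, and so do the balls (`IsGap.identified`). This yields (a) and (b); (c) is
stability together with closedness.

For the topology, X is a length space, so the ball map is 1-Lipschitz, and the induced map from the
compact quotient to the Hausdorff hyperspace is a homeomorphism onto its image. A Hausdorff space
with a finite graph structure is a quotient of finitely many points and intervals, determined by its
incidence data (`IsArcSystem.nonempty_homeomorph`). Cutting each arc into three parts removes loops
and multiple edges, which gives a simple graph with a homeomorphic realization. -/

theorem Realization.coord_add_le_one (x : Realization G) {u v : V} (h : u ≠ v) :
    x.coord u + x.coord v ≤ 1 := by
  classical
  rw [← x.sum_eq_one, ← Finset.sum_pair h]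
  exact Finset.sum_le_sum_of_subset_of_nonneg (Finset.subset_univ _) fun w _ _ => x.nonneg w

theorem Realization.coord_le_one (x : Realization G) (u : V) : x.coord u ≤ 1 := by
  rw [← x.sum_eq_one]
  exact Finset.single_le_sum (fun w _ => x.nonneg w) (Finset.mem_univ u)

theorem Realization.coord_eq_zero (x : Realization G) {u v : V} (h : u ≠ v)
    (hx : x.coord u + x.coord v = 1) {w : V} (hu : w ≠ u) (hv : w ≠ v) : x.coord w = 0 := by
  classical
  have h1 : ∑ i ∈ ({w, u, v} : Finset V), x.coord i ≤ 1 := by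
    rw [← x.sum_eq_one]
    exact Finset.sum_le_sum_of_subset_of_nonneg (Finset.subset_univ _) fun w _ _ => x.nonneg w
  rw [Finset.sum_insert (by simp [hu, hv]), Finset.sum_pair h] at h1
  linarith [x.nonneg w]

theorem Realization.coord_add_eq_one (x : Realization G) {u v : V} (h : u ≠ v)
    (hx : ∀ w, w ≠ u → w ≠ v → x.coord w = 0) : x.coord u + x.coord v = 1 := by
  classical
  rw [← x.sum_eq_one, ← Finset.sum_pair h]
  refine Finset.sum_subset (Finset.subset_univ _) fun w _ hw => ?_
  simp only [Finset.mem_insert, Finset.mem_singleton, not_or] at hw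
  exact hx w hw.1 hw.2

theorem vertexPt_self (v : V) : (vertexPt G v).coord v = 1 := by simp [vertexPt]

theorem vertexPt_ne {v w : V} (h : w ≠ v) : (vertexPt G v).coord w = 0 := by simp [vertexPt, h]

theorem eq_vertexPt_of_coord_eq_one {x : Realization G} {u : V} (h : x.coord u = 1) :
    x = vertexPt G u := by
  refine eq_vertexPt x fun w hw => ?_
  linarith [x.coord_add_le_one hw, x.nonneg w]

theorem onCommonEdge_of_add {x y : Realization G} {u v : V} (h : G.Adj u v)
    (hx : x.coord u + x.coord v = 1) (hy : y.coord u + y.coord v = 1) : OnCommonEdge x y :=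
  ⟨u, v, Or.inr h, fun _ h1 h2 => ⟨x.coord_eq_zero h.ne hx h1 h2, y.coord_eq_zero h.ne hy h1 h2⟩⟩

theorem Realization.ext_of_add {x y : Realization G} {u v : V} (h : G.Adj u v)
    (hx : x.coord u + x.coord v = 1) (hy : y.coord u + y.coord v = 1)
    (hxy : x.coord v = y.coord v) : x = y := by
  refine Realization.ext (funext fun w => ?_)
  by_cases h1 : w = u
  · subst h1; linarith
  by_cases h2 : w = v
  · subst h2; exact hxy
  rw [x.coord_eq_zero h.ne hx h1 h2, y.coord_eq_zero h.ne hy h1 h2]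

theorem dist_coord_of_add {x y : Realization G} {u v : V} (h : G.Adj u v)
    (hx : x.coord u + x.coord v = 1) (hy : y.coord u + y.coord v = 1) :
    dist x.coord y.coord = |x.coord v - y.coord v| := by
  refine le_antisymm ((dist_pi_le_iff (abs_nonneg _)).2 fun w => ?_) ?_
  · rw [Real.dist_eq]
    by_cases h1 : w = u
    · subst h1
      rw [show x.coord w = 1 - x.coord v by linarith, show y.coord w = 1 - y.coord v by linarith,
        show (1 - x.coord v - (1 - y.coord v)) = -(x.coord v - y.coord v) by ring, abs_neg]
    by_cases h2 : w = v
    · subst h2; rfl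
    rw [x.coord_eq_zero h.ne hx h1 h2, y.coord_eq_zero h.ne hy h1 h2]
    simp
  · rw [← Real.dist_eq]
    exact dist_le_pi_dist x.coord y.coord v

/-- Every point lies on a closed edge as soon as there is an edge. -/
theorem exists_edge (hG : G.Connected) {a b : V} (hab : G.Adj a b) (x : Realization G) :
    ∃ u v, G.Adj u v ∧ x.coord u + x.coord v = 1 := by
  obtain ⟨u, v, h | h, hx⟩ := x.face
  · subst h
    have : Nontrivial V := ⟨a, b, hab.ne⟩
    obtain ⟨w, hw⟩ := hG.preconnected.exists_adj_of_nontrivial u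
    exact ⟨u, w, hw, x.coord_add_eq_one hw.ne fun c h1 _ => hx c h1 h1⟩
  · exact ⟨u, v, h, x.coord_add_eq_one h.ne hx⟩

/-- A point with two nonzero coordinates determines its edge, so a polygonal path can change edges
only at a vertex. -/
theorem OnCommonEdge.trans_or {x y z : Realization G} (h : OnCommonEdge x y)
    (h' : OnCommonEdge y z) : OnCommonEdge x z ∨ ∃ w, y = vertexPt G w := by
  obtain ⟨u, v, huv, hxy⟩ := h
  obtain ⟨u', v', huv', hyz⟩ := h'
  rcases huv with rfl | huv
  · exact Or.inr ⟨u, eq_vertexPt y fun w h => (hxy w h h).2⟩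
  have hy := y.coord_add_eq_one huv.ne fun w h1 h2 => (hxy w h1 h2).2
  by_cases hu : y.coord u = 0
  · exact Or.inr ⟨v, eq_vertexPt_of_coord_eq_one (by linarith)⟩
  by_cases hv : y.coord v = 0
  · exact Or.inr ⟨u, eq_vertexPt_of_coord_eq_one (by linarith)⟩
  left
  have hu' : u = u' ∨ u = v' := by
    by_contra! hc
    exact hu (hyz u hc.1 hc.2).1
  have hv' : v = u' ∨ v = v' := by
    by_contra! hc
    exact hv (hyz v hc.1 hc.2).1
  refine ⟨u', v', huv', fun w h1 h2 => ⟨(hxy w ?_ ?_).1, (hyz w h1 h2).2⟩⟩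
  · rcases hu' with rfl | rfl <;> assumption
  · rcases hv' with rfl | rfl <;> assumption

/-! ### Distances -/

/-- A path either stays on one edge up to shortening, or it passes through an end of the edge
on which it finishes. -/
theorem IsPathLength.through_vertex {x z : Realization G} {l : ℝ} (h : IsPathLength x z l) :
    (OnCommonEdge x z ∧ dist x.coord z.coord ≤ l) ∨
      ∃ w m, OnCommonEdge (vertexPt G w) z ∧ IsPathLength x (vertexPt G w) m ∧
        m + dist (vertexPt G w).coord z.coord ≤ l := by
  induction h with
  | refl x =>
    obtain ⟨u, v, h, hx⟩ := x.face
    exact Or.inl ⟨⟨u, v, h, fun w h1 h2 => ⟨hx w h1 h2, hx w h1 h2⟩⟩, by simp⟩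
  | cons x y z l h hl ih =>
    rcases ih with ⟨hyz, hd⟩ | ⟨w, m, hw, hm, hd⟩
    · rcases h.trans_or hyz with hxz | ⟨w, rfl⟩
      · exact Or.inl ⟨hxz, (dist_triangle _ y.coord _).trans (by gcongr)⟩
      · exact Or.inr ⟨w, _, hyz, h.isPathLength, by gcongr⟩
    · exact Or.inr ⟨w, _, hw, .cons _ _ _ _ h hm, by linarith⟩

/-- The lower bound behind `dist_vertexPt_vertexPt`: no path to `a` is shorter than the route
through some vertex carrying `x`. The existential over `w` makes the induction on the path go
through. -/
theorem IsPathLength.exists_coord {x z : Realization G} {l : ℝ} (h : IsPathLength x z l)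
    (hG : G.Connected) {a : V} (hz : z = vertexPt G a) :
    ∃ w, x.coord w ≠ 0 ∧ 1 - x.coord w + (G.dist w a : ℝ) ≤ l := by
  induction h with
  | refl x => exact ⟨a, by simp [hz, vertexPt_self], by simp [hz, vertexPt_self]⟩
  | cons x y z l h hl ih =>
    obtain ⟨w, hw, hwl⟩ := ih hz
    have hd : |x.coord w - y.coord w| ≤ dist x.coord y.coord := by
      rw [← Real.dist_eq]; exact dist_le_pi_dist x.coord y.coord w
    -- If `w` no longer carries `x`, the first segment starts at the other end `b` of an edge `bw`,
    -- and `b` replaces `w` at the cost of one edge.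
    by_cases hxw : x.coord w = 0
    · obtain ⟨u, v, huv, hxy⟩ := h
      have key : ∀ b, G.Adj b w → x.coord b + x.coord w = 1 →
          ∃ w, x.coord w ≠ 0 ∧ 1 - x.coord w + (G.dist w a : ℝ) ≤ dist x.coord y.coord + l := by
        intro b hb hx
        have h1 : x.coord b = 1 := by linarith
        refine ⟨b, by simp [h1], ?_⟩
        have h2 : G.dist b a ≤ G.dist b w + G.dist w a := hG.dist_triangle
        rw [SimpleGraph.dist_eq_one_iff_adj.2 hb] at h2
        have h3 : (G.dist b a : ℝ) ≤ 1 + G.dist w a := by exact_mod_cast h2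
        have := neg_abs_le (x.coord w - y.coord w)
        rw [h1]; linarith
      have hwuv : w = u ∨ w = v := by
        by_contra! hc
        exact hw (hxy w hc.1 hc.2).2
      rcases huv with rfl | huv
      · rw [or_self] at hwuv
        subst hwuv
        have := eq_vertexPt x fun c hc => (hxy c hc hc).1
        rw [this, vertexPt_self] at hxw
        norm_num at hxw
      · have hs := x.coord_add_eq_one huv.ne fun c h1 h2 => (hxy c h1 h2).1
        rcases hwuv with rfl | rfl
        · exact key v huv.symm (by linarith)
        · exact key u huv hs
    · refine ⟨w, hxw, ?_⟩
      have := neg_abs_le (x.coord w - y.coord w)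
      linarith

section Dist

variable [hG : Fact G.Connected]

theorem dist_le_of_isPathLength {x y : Realization G} {l : ℝ} (h : IsPathLength x y l) :
    dist x y ≤ l := csInf_le (bddBelow_lengths x y) h

theorem le_dist_of_forall {x y : Realization G} {c : ℝ} (h : ∀ l, IsPathLength x y l → c ≤ l) :
    c ≤ dist x y := le_csInf (exists_isPathLength hG.out x y) fun l hl => h l hl

theorem exists_isPathLength_lt {x y : Realization G} {c : ℝ} (h : dist x y < c) :
    ∃ l < c, IsPathLength x y l := by
  by_contra! hc
  exact absurd (le_dist_of_forall fun l hl => not_lt.1 fun hlt => hc l hlt hl) (not_le.2 h)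

theorem dist_coord_le (x y : Realization G) : dist x.coord y.coord ≤ dist x y :=
  le_dist_of_forall fun _ hl => hl.le

/-- No path is shorter than the sup distance of the coordinates of its ends, so closed edges are
embedded isometrically. -/
theorem OnCommonEdge.dist_eq {x y : Realization G} (h : OnCommonEdge x y) :
    dist x y = dist x.coord y.coord :=
  le_antisymm (dist_le_of_onCommonEdge h) (dist_coord_le x y)

theorem dist_of_add {x y : Realization G} {u v : V} (h : G.Adj u v)
    (hx : x.coord u + x.coord v = 1) (hy : y.coord u + y.coord v = 1) :
    dist x y = |x.coord v - y.coord v| := by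
  rw [(onCommonEdge_of_add h hx hy).dist_eq, dist_coord_of_add h hx hy]

theorem dist_vertexPt_of_add {x : Realization G} {u v : V} (h : G.Adj u v)
    (hx : x.coord u + x.coord v = 1) : dist (vertexPt G u) x = x.coord v := by
  rw [dist_of_add h (by simp [vertexPt_self, vertexPt_ne h.ne']) hx, vertexPt_ne h.ne', zero_sub,
    abs_neg, abs_of_nonneg (x.nonneg v)]

theorem dist_vertexPt_vertexPt (u a : V) :
    dist (vertexPt G u) (vertexPt G a) = (G.dist u a : ℝ) := by
  refine le_antisymm ?_ (le_dist_of_forall fun l hl => ?_)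
  · obtain ⟨p, hp⟩ := hG.out.exists_walk_length_eq_dist u a
    rw [← hp]
    clear hp
    induction p with
    | nil => simp
    | @cons u v w h p ih =>
      refine (dist_triangle _ (vertexPt G v) _).trans ?_
      rw [dist_vertexPt_of_add h (by simp [vertexPt_self, vertexPt_ne h.ne]), vertexPt_self,
        SimpleGraph.Walk.length_cons]
      push_cast
      linarith
  · obtain ⟨w, hw, hwl⟩ := hl.exists_coord hG.out rfl
    have : w = u := by
      by_contra hc
      exact hw (vertexPt_ne hc)
    subst this
    simpa [vertexPt_self] using hwl

/-- The distance to a point of an edge, from a point which is not in the interior of that edge. -/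
theorem dist_eq_min {x p : Realization G} {a b : V} (h : G.Adj a b)
    (hx : x.coord a + x.coord b = 1 → x.coord a = 0 ∨ x.coord b = 0)
    (hp : p.coord a + p.coord b = 1) :
    dist x p = min (dist x (vertexPt G a) + p.coord b) (dist x (vertexPt G b) + p.coord a) := by
  have ha := dist_vertexPt_of_add h hp
  have hb := dist_vertexPt_of_add h.symm (by linarith : p.coord b + p.coord a = 1)
  have hta := dist_triangle x (vertexPt G a) p
  have htb := dist_triangle x (vertexPt G b) p
  have hab : dist (vertexPt G a) (vertexPt G b) = 1 := by
    rw [dist_vertexPt_of_add h (by simp [vertexPt_self, vertexPt_ne h.ne]), vertexPt_self]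
  refine le_antisymm (le_min (by linarith) (by linarith)) (le_dist_of_forall fun l hl => ?_)
  -- Here `w` is a vertex from which `p` is reached along a single edge. If it is neither `a` nor
  -- `b`, then `p` lies on `ab` and on another closed edge, so it is itself `a` or `b`.
  have key : ∀ w m, OnCommonEdge (vertexPt G w) p → dist x (vertexPt G w) ≤ m →
      m + dist (vertexPt G w) p ≤ l →
      min (dist x (vertexPt G a) + p.coord b) (dist x (vertexPt G b) + p.coord a) ≤ l := by
    intro w m hw hm hl
    by_cases hwa : w = a
    · subst hwa
      exact (min_le_left _ _).trans (by linarith)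
    by_cases hwb : w = b
    · subst hwb
      exact (min_le_right _ _).trans (by linarith)
    have hpw : p.coord w = 0 := p.coord_eq_zero h.ne hp hwa hwb
    have h1 : dist (vertexPt G w) p = 1 := by
      refine le_antisymm ?_ ?_
      · rw [hw.dist_eq, dist_pi_le_iff zero_le_one]
        intro c
        rw [Real.dist_eq, abs_le]
        constructor <;> linarith [p.nonneg c, p.coord_le_one c, (vertexPt G w).nonneg c,
          (vertexPt G w).coord_le_one c]
      · refine le_trans ?_ (dist_coord_le _ _)
        refine le_trans ?_ (dist_le_pi_dist _ _ w)
        rw [hpw, vertexPt_self, Real.dist_eq]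
        norm_num
    have h2 : p = vertexPt G a ∨ p = vertexPt G b := by
      obtain ⟨c, d, hcd, hs⟩ := hw
      have hwcd : w = c ∨ w = d := by
        by_contra! hc
        have := (hs w hc.1 hc.2).1
        rw [vertexPt_self] at this
        norm_num at this
      have hab' : (a ≠ c ∧ a ≠ d) ∨ (b ≠ c ∧ b ≠ d) := by
        by_contra! hc
        have := h.ne
        grind
      rcases hab' with hc | hc
      · have := (hs a hc.1 hc.2).2
        exact Or.inr (eq_vertexPt_of_coord_eq_one (by linarith))
      · have := (hs b hc.1 hc.2).2
        exact Or.inl (eq_vertexPt_of_coord_eq_one (by linarith))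
    have h3 := dist_triangle x (vertexPt G w) p
    rcases h2 with h2 | h2
    · refine (min_le_left _ _).trans ?_
      rw [← h2, h2, vertexPt_ne h.ne', ← h2]
      linarith
    · refine (min_le_right _ _).trans ?_
      rw [← h2, h2, vertexPt_ne h.ne, ← h2]
      linarith
  rcases hl.through_vertex with ⟨hc, hd⟩ | ⟨w, m, hw, hm, hd⟩
  · by_cases hv : ∃ w, x = vertexPt G w
    · obtain ⟨w, rfl⟩ := hv
      exact key w 0 hc (by simp) (by rw [hc.dist_eq]; linarith)
    · by_cases hpa : p.coord a = 0
      · have hpb : p = vertexPt G b := eq_vertexPt_of_coord_eq_one (by linarith)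
        refine (min_le_right _ _).trans ?_
        rw [← hpb, hpa, hc.dist_eq]
        linarith
      by_cases hpb : p.coord b = 0
      · have hpb' : p = vertexPt G a := eq_vertexPt_of_coord_eq_one (by linarith)
        refine (min_le_left _ _).trans ?_
        rw [← hpb', hpb, hc.dist_eq]
        linarith
      exfalso
      obtain ⟨c, d, hcd, hs⟩ := hc
      have h1 : a = c ∨ a = d := by
        by_contra! hc
        exact hpa (hs a hc.1 hc.2).2
      have h2 : b = c ∨ b = d := by
        by_contra! hc
        exact hpb (hs b hc.1 hc.2).2
      have hne := h.ne
      have hxab : x.coord a + x.coord b = 1 := by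
        refine x.coord_add_eq_one hne fun w hwa hwb => (hs w ?_ ?_).1 <;> grind
      rcases hx hxab with h0 | h0
      · exact hv ⟨b, eq_vertexPt_of_coord_eq_one (by linarith)⟩
      · exact hv ⟨a, eq_vertexPt_of_coord_eq_one (by linarith)⟩
  · exact key w m hw (dist_le_of_isPathLength hm) (by rw [hw.dist_eq]; exact hd)

theorem dist_vertexPt_eq_min {p : Realization G} {a b : V} (c : V) (h : G.Adj a b)
    (hp : p.coord a + p.coord b = 1) :
    dist p (vertexPt G c) = min ((G.dist c a : ℝ) + p.coord b) (G.dist c b + p.coord a) := by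
  rw [dist_comm, dist_eq_min h _ hp, dist_vertexPt_vertexPt, dist_vertexPt_vertexPt]
  intro _
  by_cases hc : a = c
  · subst hc
    exact Or.inr (vertexPt_ne h.ne')
  · exact Or.inl (vertexPt_ne hc)

theorem abs_dist_sub_le_of_adj (x : Realization G) {a b : V} (h : G.Adj a b) :
    |dist x (vertexPt G a) - dist x (vertexPt G b)| ≤ 1 := by
  have := abs_dist_sub_le (vertexPt G a) (vertexPt G b) x
  rwa [dist_vertexPt_vertexPt, SimpleGraph.dist_eq_one_iff_adj.2 h, Nat.cast_one, dist_comm _ x,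
    dist_comm _ x] at this

/-- On the half of an edge the distance from a vertex is affine with slope `±1` and integral
constant term. -/
theorem exists_dist_vertexPt_affine {u v : V} (h : G.Adj u v) (a : V) :
    ∃ n σ : ℤ, (σ = 1 ∨ σ = -1) ∧ ∀ x : Realization G, x.coord u + x.coord v = 1 →
      x.coord v ≤ 1 / 2 → dist x (vertexPt G a) = n + σ * x.coord v := by
  have h1 : G.dist a v ≤ G.dist a u + G.dist u v := hG.out.dist_triangle
  have h2 : G.dist a u ≤ G.dist a v + G.dist v u := hG.out.dist_triangle
  rw [SimpleGraph.dist_eq_one_iff_adj.2 h] at h1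
  rw [SimpleGraph.dist_eq_one_iff_adj.2 h.symm] at h2
  -- On the half near `u`, the route through `u` is shortest if `u` is no farther from `a` than `v`.
  -- Otherwise `u` is farther by exactly one and the route through `v` is shortest.
  rcases le_or_gt (G.dist a u) (G.dist a v) with h3 | h3
  · refine ⟨G.dist a u, 1, Or.inl rfl, fun x hx hx' => ?_⟩
    have h3' : (G.dist a u : ℝ) ≤ G.dist a v := by exact_mod_cast h3
    rw [dist_vertexPt_eq_min a h hx, min_eq_left (by linarith)]
    push_cast; ring
  · have h4 : G.dist a u = G.dist a v + 1 := by omega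
    refine ⟨G.dist a u, -1, Or.inr rfl, fun x hx hx' => ?_⟩
    rw [dist_vertexPt_eq_min a h hx, h4, min_eq_right (by push_cast; linarith [x.nonneg v])]
    push_cast; linarith

end Dist

end FiniteMetricGraph

namespace FiniteMetricGraph

/-! ### The cut positions -/

section Cut

variable {ε : ℝ}

theorem halfRem_nonneg (ε : ℝ) : 0 ≤ halfRem ε := by
  unfold halfRem; linarith [Int.floor_le (2 * ε)]

theorem halfRem_lt (ε : ℝ) : halfRem ε < 1 / 2 := by
  unfold halfRem; linarith [Int.lt_floor_add_one (2 * ε)]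

theorem cutSet_finite (ε : ℝ) : (cutSet ε).Finite := by
  unfold cutSet; exact Set.toFinite _

theorem zero_mem_cutSet (ε : ℝ) : (0 : ℝ) ∈ cutSet ε := by simp [cutSet]

theorem one_mem_cutSet (ε : ℝ) : (1 : ℝ) ∈ cutSet ε := by simp [cutSet]

theorem half_mem_cutSet (ε : ℝ) : (1 / 2 : ℝ) ∈ cutSet ε := by simp [cutSet]

theorem cutSet_subset_Icc (ε : ℝ) : cutSet ε ⊆ Icc 0 1 := by
  have h0 := halfRem_nonneg ε
  have h1 := halfRem_lt ε
  rintro t (rfl | rfl | rfl | rfl | rfl | rfl | rfl) <;> constructor <;> linarith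

theorem one_sub_mem_cutSet {t : ℝ} (h : t ∈ cutSet ε) : 1 - t ∈ cutSet ε := by
  simp only [cutSet, mem_insert_iff, mem_singleton_iff] at h ⊢
  rcases h with rfl | rfl | rfl | rfl | rfl | rfl | rfl
  · simp
  · simp
  · right; right; right; right; left; ring
  · right; right; right; left; norm_num
  · right; right; left; ring
  · right; left; ring
  · simp

/-- This is what the cut positions are for. Modulo integers 2ε is twice `halfRem ε`, which lies in
[0, 1), so only the integers 0, 1, 2 can occur for t in [0, 1]. -/
theorem mem_cutSet_of_two_mul {t : ℝ} (h0 : 0 ≤ t) (h1 : t ≤ 1) (k : ℤ)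
    (h : 2 * t = 2 * ε + k ∨ 2 * t = -(2 * ε) + k) : t ∈ cutSet ε := by
  have hr0 := halfRem_nonneg ε
  have hr1 := halfRem_lt ε
  have hr : 2 * ε = 2 * halfRem ε + ⌊2 * ε⌋ := by unfold halfRem; ring
  simp only [cutSet, mem_insert_iff, mem_singleton_iff]
  generalize halfRem ε = r at *
  rcases h with h | h
  · obtain ⟨j, hj⟩ : ∃ j : ℤ, ⌊2 * ε⌋ + k = j := ⟨_, rfl⟩
    have hj' : 2 * t = 2 * r + j := by rw [← hj]; push_cast; linarith
    have l1 : (-1 : ℤ) < j := by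
      have : (-1 : ℝ) < j := by linarith
      exact_mod_cast this
    have l2 : j < 3 := by
      have : (j : ℝ) < 3 := by linarith
      exact_mod_cast this
    interval_cases j <;> norm_num at hj'
    · right; left; linarith
    · right; right; right; right; left; linarith
    · right; right; right; right; right; right; linarith
  · obtain ⟨j, hj⟩ : ∃ j : ℤ, -⌊2 * ε⌋ + k = j := ⟨_, rfl⟩
    have hj' : 2 * t = -2 * r + j := by rw [← hj]; push_cast; linarith
    have l1 : (-1 : ℤ) < j := by
      have : (-1 : ℝ) < j := by linarith
      exact_mod_cast this
    have l2 : j < 3 := by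
      have : (j : ℝ) < 3 := by linarith
      exact_mod_cast this
    interval_cases j <;> norm_num at hj'
    · left; linarith
    · right; right; left; linarith
    · right; right; right; right; right; left; linarith

/-- `(α, β)` is a gap between consecutive cut positions in the half edge `[0, 1 / 2]`. -/
structure IsGap (ε α β : ℝ) : Prop where
  left_mem : α ∈ cutSet ε
  right_mem : β ∈ cutSet ε
  lt : α < β
  le_half : β ≤ 1 / 2
  gap : ∀ c ∈ cutSet ε, ¬ (α < c ∧ c < β)

theorem IsGap.nonneg {α β : ℝ} (h : IsGap ε α β) : 0 ≤ α := (cutSet_subset_Icc ε h.left_mem).1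

theorem IsGap.unique {α β α' β' t : ℝ} (h : IsGap ε α β) (h' : IsGap ε α' β')
    (ht : t ∈ Ioo α β) (ht' : t ∈ Ioo α' β') : α = α' ∧ β = β' := by
  have h1 := h.gap α' h'.left_mem
  have h2 := h.gap β' h'.right_mem
  have h3 := h'.gap α h.left_mem
  have h4 := h'.gap β h.right_mem
  simp only [not_and, not_lt] at h1 h2 h3 h4
  obtain ⟨a1, a2⟩ := ht
  obtain ⟨b1, b2⟩ := ht'
  refine ⟨le_antisymm ?_ ?_, le_antisymm ?_ ?_⟩ <;> by_contra! hc
  · linarith [h3 hc]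
  · linarith [h1 hc]
  · linarith [h2 (a1.trans b2)]
  · linarith [h4 (b1.trans a2)]

/-- The sign of `N + τ s - 2 ε`, where `N` is an integer and `τ = ± 2` or `τ = 0`, is constant on
a gap. -/
theorem IsGap.stable {α β : ℝ} (h : IsGap ε α β) {s t : ℝ} (hs : s ∈ Ioo α β) (ht : t ∈ Ioo α β)
    (N τ : ℤ) (hτ : τ = 2 ∨ τ = 0 ∨ τ = -2) (hle : N + τ * s ≤ 2 * ε) : N + τ * t ≤ 2 * ε := by
  by_contra! hc
  have h0 := h.nonneg
  have h1 := h.le_half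
  obtain ⟨s1, s2⟩ := hs
  obtain ⟨t1, t2⟩ := ht
  rcases hτ with rfl | rfl | rfl
  · push_cast at hle hc
    refine h.gap ((2 * ε - N) / 2) (mem_cutSet_of_two_mul (by linarith) (by linarith) (-N)
      (Or.inl (by push_cast; ring))) ⟨by linarith, by linarith⟩
  · push_cast at hle hc
    linarith
  · push_cast at hle hc
    refine h.gap ((N - 2 * ε) / 2) (mem_cutSet_of_two_mul (by linarith) (by linarith) N
      (Or.inr (by ring))) ⟨by linarith, by linarith⟩

end Cut

variable {V : Type*} [Fintype V] {G : SimpleGraph V}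

theorem exists_point {u v : V} (h : G.Adj u v) {s : ℝ} (h0 : 0 ≤ s) (h1 : s ≤ 1) :
    ∃ x : Realization G, x.coord u + x.coord v = 1 ∧ x.coord v = s := by
  refine ⟨edgePt u v h ⟨1 - s, by linarith, by linarith⟩, ?_, ?_⟩ <;> simp [edgePt, h.ne, h.ne']

/-- Carries the hypothesis of `dist_eq_min` along an edge: since `x` is interior to `uv`, the edge
`ab` is a different one, and no point of `uv` is interior to it. -/
theorem interior_transfer {u v a b : V} (h : G.Adj u v) (hab : G.Adj a b) {x y : Realization G}
    (hx : x.coord u + x.coord v = 1) (hy : y.coord u + y.coord v = 1)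
    (hxu : x.coord u ≠ 0) (hxv : x.coord v ≠ 0)
    (hxab : x.coord a + x.coord b = 1 → x.coord a = 0 ∨ x.coord b = 0) :
    y.coord a + y.coord b = 1 → y.coord a = 0 ∨ y.coord b = 0 := by
  intro _
  by_contra! hc
  have ha : a = u ∨ a = v := by
    by_contra! hn
    exact hc.1 (y.coord_eq_zero h.ne hy hn.1 hn.2)
  have hb : b = u ∨ b = v := by
    by_contra! hn
    exact hc.2 (y.coord_eq_zero h.ne hy hn.1 hn.2)
  have hne := hab.ne
  rcases ha with rfl | rfl <;> rcases hb with rfl | rfl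
  · exact hne rfl
  · exact (hxab hx).elim hxu hxv
  · exact (hxab (by linarith)).elim hxv hxu
  · exact hne rfl

theorem IsGap.ne_zero {ε α β : ℝ} (hg : IsGap ε α β) {u v : V} {x : Realization G}
    (hx : x.coord u + x.coord v = 1) (hxg : x.coord v ∈ Ioo α β) :
    x.coord u ≠ 0 ∧ x.coord v ≠ 0 := by
  have := hg.nonneg
  have := hg.le_half
  constructor <;> intro h0 <;> linarith [hxg.1, hxg.2]

variable [hG : Fact G.Connected] {ε : ℝ}

/-! ### Balls and edges -/

/-- An interior point of an edge not contained in its ball is determined by its ball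
(the uncovered part being towards `v`). -/
theorem eq_of_uncovered_right {u v : V} (h : G.Adj u v) (hε : 0 ≤ ε) {x x' : Realization G}
    (hx : x.coord u + x.coord v = 1) (h0 : 0 < x.coord v)
    (hB : closedBall x ε = closedBall x' ε) {p : Realization G}
    (hp : x.coord v + ε < p.coord v) : x' = x := by
  have hp1 := p.coord_le_one v
  -- `z` is the last point of the ball on the way from `x` towards `v`.
  obtain ⟨z, hz, hzv⟩ := exists_point h (s := x.coord v + ε) (by linarith) (by linarith)
  have hzx : z ∈ closedBall x' ε := by
    rw [← hB, mem_closedBall, dist_of_add h hz hx, hzv, abs_le]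
    constructor <;> linarith
  have hx'x : x' ∈ closedBall x ε := hB ▸ mem_closedBall_self hε
  rw [mem_closedBall] at hzx hx'x
  by_cases hx' : x'.coord u + x'.coord v = 1
  · refine Realization.ext_of_add h hx' hx ?_
    rw [dist_of_add h hz hx', abs_le] at hzx
    rw [dist_of_add h hx' hx, abs_le] at hx'x
    by_contra hne
    have hlt : x.coord v < x'.coord v := lt_of_le_of_ne (by linarith) (Ne.symm hne)
    -- If `x'` were closer to `v`, its ball would contain a point `y` beyond `z`, which the ball
    -- about `x` misses.
    obtain ⟨y, hy, hyv⟩ := exists_point h (s := min (p.coord v) (x'.coord v + ε))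
      (le_min (p.nonneg v) (by linarith)) (min_le_of_left_le hp1)
    have hyx : y ∈ closedBall x ε := by
      rw [hB, mem_closedBall, dist_of_add h hy hx', hyv, abs_le]
      have : x'.coord v - ε ≤ min (p.coord v) (x'.coord v + ε) :=
        le_min (by linarith) (by linarith)
      constructor
      · linarith
      · linarith [min_le_right (p.coord v) (x'.coord v + ε)]
    rw [mem_closedBall, dist_of_add h hy hx, hyv, abs_le] at hyx
    have : x.coord v + ε < min (p.coord v) (x'.coord v + ε) := lt_min hp (by linarith)
    linarith
  · exfalso
    rw [dist_comm, dist_eq_min h (fun h => absurd h hx') hz, min_le_iff] at hzx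
    -- From outside the edge, `z` cannot be reached through `u`, since it is farther than ε from
    -- `u`. Reaching it through `v` would put `v` in the ball, although `v` lies beyond `z`.
    rcases hzx with hzx | hzx
    · linarith [dist_nonneg (x := x') (y := vertexPt G u)]
    · have hv : vertexPt G v ∈ closedBall x ε := by
        rw [hB, mem_closedBall, dist_comm]
        linarith [z.nonneg u]
      rw [mem_closedBall, dist_vertexPt_of_add h.symm (by linarith)] at hv
      linarith

/-- If the ball about an interior point of an edge is also centred elsewhere, it contains the
edge. -/
theorem edge_subset_ball {u v : V} (h : G.Adj u v) (hε : 0 ≤ ε) {x x' : Realization G}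
    (hx : x.coord u + x.coord v = 1) (hu : x.coord u ≠ 0) (hv : x.coord v ≠ 0)
    (hB : closedBall x ε = closedBall x' ε) (hne : x' ≠ x) {p : Realization G}
    (hp : p.coord u + p.coord v = 1) : dist x p ≤ ε := by
  rw [dist_of_add h hx hp, abs_le]
  constructor <;> by_contra! hc
  · exact hne (eq_of_uncovered_right h hε hx (lt_of_le_of_ne (x.nonneg v) (Ne.symm hv)) hB (p := p)
      (by linarith))
  · exact hne (eq_of_uncovered_right h.symm hε (by linarith)
      (lt_of_le_of_ne (x.nonneg u) (Ne.symm hu)) hB (p := p) (by linarith))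

/-- An edge is covered by a ball centred outside its interior if and only if the parts reached from
its two ends overlap. -/
theorem edge_covered_iff {x : Realization G} {a b : V} (h : G.Adj a b)
    (hx : x.coord a + x.coord b = 1 → x.coord a = 0 ∨ x.coord b = 0) :
    (∀ p : Realization G, p.coord a + p.coord b = 1 → dist x p ≤ ε) ↔
      dist x (vertexPt G a) + dist x (vertexPt G b) + 1 ≤ 2 * ε := by
  have hab := abs_le.1 (abs_dist_sub_le_of_adj x h)
  constructor
  · intro hc
    -- The point of the edge where the routes through `a` and through `b` have equal length is the
    -- last to be covered.
    obtain ⟨p, hp, hpb⟩ := exists_point h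
      (s := (1 + dist x (vertexPt G b) - dist x (vertexPt G a)) / 2) (by linarith) (by linarith)
    have := hc p hp
    rw [dist_eq_min h hx hp, min_le_iff] at this
    rcases this with h1 | h1 <;> linarith
  · intro hc p hp
    rw [dist_eq_min h hx hp, min_le_iff]
    by_contra! hc'
    linarith [hc'.1, hc'.2]

/-- If `x'` were farther from `a`, the ball about `x` would extend from `a` farther along `ab` than
the ball about `x'` does, into the part that the latter leaves uncovered. -/
theorem dist_vertexPt_le_of_subset {x x' : Realization G} {a b : V} (h : G.Adj a b)
    (hx : x.coord a + x.coord b = 1 → x.coord a = 0 ∨ x.coord b = 0)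
    (hx' : x'.coord a + x'.coord b = 1 → x'.coord a = 0 ∨ x'.coord b = 0)
    (hB : closedBall x ε ⊆ closedBall x' ε) (ha : dist x (vertexPt G a) ≤ ε)
    (hc : ¬ ∀ p : Realization G, p.coord a + p.coord b = 1 → dist x' p ≤ ε) :
    dist x' (vertexPt G a) ≤ dist x (vertexPt G a) := by
  rw [edge_covered_iff h hx', not_le] at hc
  by_contra! hlt
  have hab := abs_le.1 (abs_dist_sub_le_of_adj x' h)
  -- Up to the balance point `m` the route from `x'` through `b` is no shorter than the one through
  -- `a`, so truncating at `m` keeps `p` out of reach from both ends.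
  set m := (1 + dist x' (vertexPt G b) - dist x' (vertexPt G a)) / 2 with hm
  obtain ⟨p, hp, hpb⟩ := exists_point h (s := min (ε - dist x (vertexPt G a)) m)
    (le_min (by linarith) (by linarith)) (min_le_of_right_le (by linarith))
  have h1 := min_le_left (ε - dist x (vertexPt G a)) m
  have h2 := min_le_right (ε - dist x (vertexPt G a)) m
  have h3 : ε - dist x' (vertexPt G a) < min (ε - dist x (vertexPt G a)) m :=
    lt_min (by linarith) (by linarith)
  have hpx : p ∈ closedBall x' ε := by
    refine hB ?_
    rw [mem_closedBall, dist_comm, dist_eq_min h hx hp]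
    exact min_le_of_left_le (by linarith)
  rw [mem_closedBall, dist_comm, dist_eq_min h hx' hp, min_le_iff] at hpx
  rcases hpx with h4 | h4 <;> linarith

/-- If the chosen end of the edge of a missed point is not reached, a walk to it from `u` must cross
from a reached vertex to an unreached one. -/
theorem exists_partial_edge {x : Realization G} {u v : V} (huv : G.Adj u v)
    (hu : dist x (vertexPt G u) ≤ ε) (hB : closedBall x ε ≠ univ) :
    ∃ a b, G.Adj a b ∧ dist x (vertexPt G a) ≤ ε ∧
      ¬ ∀ p : Realization G, p.coord a + p.coord b = 1 → dist x p ≤ ε := by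
  obtain ⟨p, hp⟩ := (ne_univ_iff_exists_notMem _).1 hB
  rw [mem_closedBall, dist_comm] at hp
  obtain ⟨a, b, hab, hpab⟩ := exists_edge hG.out huv p
  by_cases ha : dist x (vertexPt G a) ≤ ε
  · exact ⟨a, b, hab, ha, fun h => hp (h p hpab)⟩
  · obtain ⟨w⟩ := hG.out.preconnected u a
    obtain ⟨d, -, h1, h2⟩ := w.exists_boundary_dart {c | dist x (vertexPt G c) ≤ ε} hu ha
    refine ⟨d.fst, d.snd, d.adj, h1, fun h => h2 (h _ ?_)⟩
    rw [vertexPt_self, vertexPt_ne d.adj.ne, zero_add]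

theorem IsGap.vertex_stable {α β : ℝ} (hg : IsGap ε α β) {u v : V} (h : G.Adj u v)
    {x y : Realization G} (hx : x.coord u + x.coord v = 1) (hy : y.coord u + y.coord v = 1)
    (hxg : x.coord v ∈ Ioo α β) (hyg : y.coord v ∈ Ioo α β) {a : V}
    (ha : dist x (vertexPt G a) ≤ ε) : dist y (vertexPt G a) ≤ ε := by
  obtain ⟨n, σ, hσ, H⟩ := exists_dist_vertexPt_affine h a
  rw [H x hx (hxg.2.le.trans hg.le_half)] at ha
  rw [H y hy (hyg.2.le.trans hg.le_half)]
  have := hg.stable hxg hyg (2 * n) (2 * σ) (by omega) (by push_cast; linarith)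
  push_cast at this
  linarith

/-- For an edge without `x` in its interior, the covering inequality has slope σ + τ with both signs
±1, hence 0 or ±2, as `IsGap.stable` requires. -/
theorem IsGap.edge_stable {α β : ℝ} (hg : IsGap ε α β) {u v : V} (h : G.Adj u v)
    {x y : Realization G} (hx : x.coord u + x.coord v = 1) (hy : y.coord u + y.coord v = 1)
    (hxg : x.coord v ∈ Ioo α β) (hyg : y.coord v ∈ Ioo α β) {a b : V} (hab : G.Adj a b)
    (hc : ∀ p : Realization G, p.coord a + p.coord b = 1 → dist x p ≤ ε) :
    ∀ p : Realization G, p.coord a + p.coord b = 1 → dist y p ≤ ε := by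
  -- On the edge carrying `x`, in the half near `u`, the farthest point is `v`; covering means 2 -
  -- 2s ≤ 2ε.
  have own : (∀ p : Realization G, p.coord u + p.coord v = 1 → dist x p ≤ ε) →
      ∀ p : Realization G, p.coord u + p.coord v = 1 → dist y p ≤ ε := by
    intro hc p hp
    have h1 := hc (vertexPt G v) (by simp [vertexPt_self, vertexPt_ne h.ne])
    rw [dist_comm, dist_vertexPt_of_add h.symm (by linarith)] at h1
    have h2 := hg.stable hxg hyg 2 (-2) (by simp) (by push_cast; linarith)
    push_cast at h2
    have := hg.le_half
    rw [dist_of_add h hy hp, abs_le]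
    constructor <;> linarith [p.coord_le_one v, p.nonneg v, hyg.2]
  by_cases hxab : x.coord a + x.coord b = 1 → x.coord a = 0 ∨ x.coord b = 0
  · obtain ⟨hxu, hxv⟩ := hg.ne_zero hx hxg
    have hyab := interior_transfer h hab hx hy hxu hxv hxab
    rw [edge_covered_iff hab hxab] at hc
    rw [edge_covered_iff hab hyab]
    obtain ⟨n, σ, hσ, H⟩ := exists_dist_vertexPt_affine h a
    obtain ⟨m, τ, hτ, K⟩ := exists_dist_vertexPt_affine h b
    rw [H x hx (hxg.2.le.trans hg.le_half), K x hx (hxg.2.le.trans hg.le_half)] at hc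
    rw [H y hy (hyg.2.le.trans hg.le_half), K y hy (hyg.2.le.trans hg.le_half)]
    have := hg.stable hxg hyg (n + m + 1) (σ + τ) (by omega) (by push_cast; linarith)
    push_cast at this
    linarith
  · push Not at hxab
    obtain ⟨-, hxa, hxb⟩ := hxab
    have ha : a = u ∨ a = v := by
      by_contra! hn
      exact hxa (x.coord_eq_zero h.ne hx hn.1 hn.2)
    have hb : b = u ∨ b = v := by
      by_contra! hn
      exact hxb (x.coord_eq_zero h.ne hx hn.1 hn.2)
    have hne := hab.ne
    rcases ha with rfl | rfl <;> rcases hb with rfl | rfl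
    · exact absurd rfl hne
    · exact own hc
    · exact fun p hp => own (fun p hp => hc p (by linarith)) p (by linarith)
    · exact absurd rfl hne

/-- If one point of an open edge of the subdivision has the whole space as its ball, then so does
every other point of it. -/
theorem IsGap.ball_eq_univ {α β : ℝ} (hg : IsGap ε α β) {u v : V} (h : G.Adj u v)
    {x y : Realization G} (hx : x.coord u + x.coord v = 1) (hy : y.coord u + y.coord v = 1)
    (hxg : x.coord v ∈ Ioo α β) (hyg : y.coord v ∈ Ioo α β) (hB : closedBall x ε = univ) :
    closedBall y ε = univ := by
  refine eq_univ_of_forall fun p => ?_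
  obtain ⟨a, b, hab, hp⟩ := exists_edge hG.out h p
  rw [mem_closedBall, dist_comm]
  refine hg.edge_stable h hx hy hxg hyg hab (fun q _ => ?_) p hp
  have : q ∈ closedBall x ε := hB ▸ mem_univ q
  rwa [mem_closedBall, dist_comm] at this

/-- The integer n - n' equals σ's' - σs, whose absolute value is less than 1, so it vanishes;
positivity of `s` then fixes the sign. -/
theorem affine_match {s s' : ℝ} (hs : 0 < s) (hs2 : s < 1 / 2) (hs' : 0 ≤ s') (hs2' : s' ≤ 1 / 2)
    {n n' σ σ' : ℤ} (hσ : σ = 1 ∨ σ = -1) (hσ' : σ' = 1 ∨ σ' = -1)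
    (h : (n : ℝ) + σ * s = n' + σ' * s') : s' = s ∧ σ' = σ ∧ n' = n := by
  obtain ⟨k, hk⟩ : ∃ k : ℤ, n - n' = k := ⟨_, rfl⟩
  have hk' : (k : ℝ) = σ' * s' - σ * s := by rw [← hk]; push_cast; linarith
  have l1 : (-1 : ℤ) < k := by
    have : (-1 : ℝ) < k := by rcases hσ with rfl | rfl <;> rcases hσ' with rfl | rfl <;>
      push_cast at hk' <;> linarith
    exact_mod_cast this
  have l2 : k < 1 := by
    have : (k : ℝ) < 1 := by rcases hσ with rfl | rfl <;> rcases hσ' with rfl | rfl <;>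
      push_cast at hk' <;> linarith
    exact_mod_cast this
  have hk0 : k = 0 := by omega
  subst hk0
  refine ⟨?_, ?_, by omega⟩
  · rcases hσ with rfl | rfl <;> rcases hσ' with rfl | rfl <;> push_cast at hk' <;> linarith
  · rcases hσ with rfl | rfl <;> rcases hσ' with rfl | rfl <;> push_cast at hk'
    · rfl
    · linarith
    · linarith
    · rfl

/-- Two points with the same ball, different from the space, one of which lies in an open edge
of the subdivision: the other one has the same position, and all points of the open edge are
identified with those at the same position. -/
theorem IsGap.identified {α β : ℝ} (hg : IsGap ε α β) (hε : 0 ≤ ε) {u v u' v' : V} (h : G.Adj u v)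
    (h' : G.Adj u' v') {x x' : Realization G}
    (hx : x.coord u + x.coord v = 1) (hx' : x'.coord u' + x'.coord v' = 1)
    (hxg : x.coord v ∈ Ioo α β) (hx2 : x'.coord v' ≤ 1 / 2) (hB : closedBall x ε = closedBall x' ε)
    (hne : x' ≠ x) (hU : closedBall x ε ≠ univ) :
    x'.coord v' = x.coord v ∧ ∀ y y' : Realization G, y.coord u + y.coord v = 1 →
      y'.coord u' + y'.coord v' = 1 → y.coord v ∈ Ioo α β → y'.coord v' = y.coord v →
      closedBall y ε = closedBall y' ε := by
  obtain ⟨hxu, hxv⟩ := hg.ne_zero hx hxg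
  have hmem : ∀ p, dist x p ≤ ε ↔ dist x' p ≤ ε := fun p => by
    rw [dist_comm x, dist_comm x', ← mem_closedBall, ← mem_closedBall, hB]
  have ni : ∀ {a b : V}, G.Adj a b →
      (¬ ∀ p : Realization G, p.coord a + p.coord b = 1 → dist x p ≤ ε) →
      x.coord a + x.coord b = 1 → x.coord a = 0 ∨ x.coord b = 0 := by
    intro a b hab hc hxab
    by_contra! hn
    exact hc fun p hp => edge_subset_ball hab hε hxab hn.1 hn.2 hB hne hp
  have ni' : ∀ {a b : V}, G.Adj a b →
      (¬ ∀ p : Realization G, p.coord a + p.coord b = 1 → dist x p ≤ ε) →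
      x'.coord a + x'.coord b = 1 → x'.coord a = 0 ∨ x'.coord b = 0 := by
    intro a b hab hc hxab
    by_contra! hn
    exact hc fun p hp => (hmem p).2 (edge_subset_ball hab hε hxab hn.1 hn.2 hB.symm hne.symm hp)
  -- By `ni` and `ni'` neither centre is interior to an uncovered edge, so both inclusions of balls
  -- can be compared at a reached end.
  have deq : ∀ {a b : V}, G.Adj a b → dist x (vertexPt G a) ≤ ε →
      (¬ ∀ p : Realization G, p.coord a + p.coord b = 1 → dist x p ≤ ε) →
      dist x (vertexPt G a) = dist x' (vertexPt G a) := by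
    intro a b hab ha hc
    refine le_antisymm (dist_vertexPt_le_of_subset hab (ni' hab hc) (ni hab hc) hB.symm.subset
      ((hmem _).1 ha) hc) (dist_vertexPt_le_of_subset hab (ni hab hc) (ni' hab hc) hB.subset ha
      fun hc' => hc fun p hp => (hmem p).2 (hc' p hp))
  have hxlt : x.coord v < 1 / 2 := hxg.2.trans_le hg.le_half
  have hx0 : 0 < x.coord v := hg.nonneg.trans_lt hxg.1
  have sEq : x'.coord v' = x.coord v := by
    obtain ⟨a, b, hab, ha, hc⟩ := exists_partial_edge h (edge_subset_ball h hε hx hxu hxv hB hne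
      (by simp [vertexPt_self, vertexPt_ne h.ne']) : dist x (vertexPt G u) ≤ ε) hU
    obtain ⟨n, σ, hσ, H⟩ := exists_dist_vertexPt_affine h a
    obtain ⟨m, τ, hτ, K⟩ := exists_dist_vertexPt_affine h' a
    have := deq hab ha hc
    rw [H x hx hxlt.le, K x' hx' hx2] at this
    exact (affine_match hx0 hxlt (x'.nonneg _) hx2 hσ hτ this).1
  have hxg' : x'.coord v' ∈ Ioo α β := sEq ▸ hxg
  refine ⟨sEq, fun y y' hy hy' hyg hyy => ?_⟩
  have hyg' : y'.coord v' ∈ Ioo α β := hyy ▸ hyg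
  obtain ⟨hxu', hxv'⟩ := hg.ne_zero hx' hxg'
  ext p
  obtain ⟨a, b, hab, hp⟩ := exists_edge hG.out h p
  rw [mem_closedBall, dist_comm, mem_closedBall, dist_comm _ y']
  by_cases hc : ∀ p : Realization G, p.coord a + p.coord b = 1 → dist x p ≤ ε
  · have h1 := hg.edge_stable h hx hy hxg hyg hab hc p hp
    have h2 := hg.edge_stable h' hx' hy' hxg' hyg' hab (fun q hq => (hmem q).1 (hc q hq)) p hp
    exact iff_of_true h1 h2
  -- At a reached end of an uncovered edge `y` and `y'` share one affine formula. An unreached end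
  -- stays unreached, and the route through it serves neither ball.
  · have vtx : ∀ {a b : V}, G.Adj a b →
        (¬ ∀ p : Realization G, p.coord a + p.coord b = 1 → dist x p ≤ ε) →
        dist y (vertexPt G a) = dist y' (vertexPt G a) ∨
          (ε < dist y (vertexPt G a) ∧ ε < dist y' (vertexPt G a)) := by
      intro a b hab hc
      by_cases ha : dist x (vertexPt G a) ≤ ε
      · left
        obtain ⟨n, σ, hσ, H⟩ := exists_dist_vertexPt_affine h a
        obtain ⟨m, τ, hτ, K⟩ := exists_dist_vertexPt_affine h' a
        have := deq hab ha hc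
        rw [H x hx hxlt.le, K x' hx' hx2] at this
        obtain ⟨-, rfl, rfl⟩ := affine_match hx0 hxlt (x'.nonneg _) hx2 hσ hτ this
        rw [H y hy (hyg.2.le.trans hg.le_half), K y' hy' (hyg'.2.le.trans hg.le_half), hyy]
      · right
        constructor <;> by_contra! hn
        · exact ha (hg.vertex_stable h hy hx hyg hxg hn)
        · exact ha ((hmem _).2 (hg.vertex_stable h' hy' hx' hyg' hxg' hn))
    have hc' : ¬ ∀ p : Realization G, p.coord b + p.coord a = 1 → dist x p ≤ ε :=
      fun hn => hc fun p hp => hn p (by linarith)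
    rw [dist_eq_min hab (interior_transfer h hab hx hy hxu hxv (ni hab hc)) hp,
      dist_eq_min hab (interior_transfer h' hab hx' hy' hxu' hxv' (ni' hab hc)) hp,
      min_le_iff, min_le_iff]
    have pa := p.nonneg a
    have pb := p.nonneg b
    refine or_congr ?_ ?_
    · rcases vtx hab hc with h1 | ⟨h1, h2⟩
      · rw [h1]
      · constructor <;> intro _ <;> linarith
    · rcases vtx hab.symm hc' with h1 | ⟨h1, h2⟩
      · rw [h1]
      · constructor <;> intro _ <;> linarith

end FiniteMetricGraph

namespace FiniteMetricGraph

variable {V : Type*} [Fintype V] {G : SimpleGraph V}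

/-! ### Open edges of the subdivision -/

/-- The open segment of the half edge at `u` of the edge `uv` between the distances `α` and `β`
from `u`. -/
def openEdge (G : SimpleGraph V) (u v : V) (α β : ℝ) : Set (Realization G) :=
  {x | x.coord u + x.coord v = 1 ∧ x.coord v ∈ Ioo α β}

/-- Since 1/2 is a cut position, each open edge lies in one half of its edge; reflection t ↦ 1 - t
allows measuring from the nearer end. -/
theorem mem_subdivEdges_iff {ε : ℝ} {e : Set (Realization G)} :
    e ∈ subdivEdges G ε ↔ ∃ u v α β, G.Adj u v ∧ IsGap ε α β ∧ e = openEdge G u v α β := by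
  constructor
  · rintro ⟨u, v, a, b, h, ha, hb, hab, hgap, rfl⟩
    rcases le_or_gt b (1 / 2) with hb2 | hb2
    · refine ⟨v, u, a, b, h.symm, ⟨ha, hb, hab, hb2, hgap⟩, ?_⟩
      ext x
      simp [openEdge, add_comm]
    · have ha2 : 1 / 2 ≤ a := by
        by_contra! hc
        exact hgap _ (half_mem_cutSet ε) ⟨hc, hb2⟩
      refine ⟨u, v, 1 - b, 1 - a, h, ⟨one_sub_mem_cutSet hb, one_sub_mem_cutSet ha, by linarith,
        by linarith, fun c hc hcc => hgap (1 - c) (one_sub_mem_cutSet hc)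
          ⟨by linarith [hcc.2], by linarith [hcc.1]⟩⟩, ?_⟩
      ext x
      simp only [openEdge, mem_ofPred_eq, mem_Ioo]
      constructor
      · rintro ⟨h1, h2, h3⟩
        exact ⟨h1, by linarith, by linarith⟩
      · rintro ⟨h1, h2, h3⟩
        exact ⟨h1, by linarith, by linarith⟩
  · rintro ⟨u, v, α, β, h, hg, rfl⟩
    refine ⟨v, u, α, β, h.symm, hg.left_mem, hg.right_mem, hg.lt, hg.gap, ?_⟩
    ext x
    simp [openEdge, add_comm]

theorem exists_gap {ε s : ℝ} (h0 : 0 ≤ s) (h2 : s ≤ 1 / 2) (hs : s ∉ cutSet ε) :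
    ∃ α β, IsGap ε α β ∧ s ∈ Ioo α β := by
  obtain ⟨α, ⟨hα, hαs⟩, hαm⟩ := ((cutSet_finite ε).inter_of_left {t | t ≤ s}).exists_maximal
    ⟨0, zero_mem_cutSet ε, h0⟩
  obtain ⟨β, ⟨hβ, hβs⟩, hβm⟩ := ((cutSet_finite ε).inter_of_left {t | s ≤ t}).exists_minimal
    ⟨1 / 2, half_mem_cutSet ε, h2⟩
  have hα' : α < s := lt_of_le_of_ne hαs fun h => hs (h ▸ hα)
  have hβ' : s < β := lt_of_le_of_ne hβs fun h => hs (h ▸ hβ)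
  refine ⟨α, β, ⟨hα, hβ, hα'.trans hβ', ?_, fun c hc hcc => ?_⟩, hα', hβ'⟩
  · by_contra! hc
    exact absurd (hβm ⟨half_mem_cutSet ε, h2⟩ hc.le) (not_le.2 hc)
  · rcases le_total c s with h | h
    · exact absurd (hαm ⟨hc, h⟩ hcc.1.le) (not_le.2 hcc.1)
    · exact absurd (hβm ⟨hc, h⟩ hcc.2.le) (not_le.2 hcc.2)

theorem mem_subdivVertices_of_add {ε : ℝ} {u v : V} (h : G.Adj u v) {x : Realization G}
    (hx : x.coord u + x.coord v = 1) (hv : x.coord v ∈ cutSet ε) : x ∈ subdivVertices G ε := by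
  intro w
  by_cases h1 : w = u
  · subst h1
    rw [show x.coord w = 1 - x.coord v by linarith]
    exact one_sub_mem_cutSet hv
  by_cases h2 : w = v
  · subst h2; exact hv
  rw [x.coord_eq_zero h.ne hx h1 h2]
  exact zero_mem_cutSet ε

theorem vertexPt_mem_subdivVertices (ε : ℝ) (v : V) : vertexPt G v ∈ subdivVertices G ε := by
  intro w
  by_cases h : w = v
  · subst h; rw [vertexPt_self]; exact one_mem_cutSet ε
  · rw [vertexPt_ne h]; exact zero_mem_cutSet ε

theorem exists_half_edge (hG : G.Connected) {a b : V} (hab : G.Adj a b) (x : Realization G) :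
    ∃ u v, G.Adj u v ∧ x.coord u + x.coord v = 1 ∧ x.coord v ≤ 1 / 2 := by
  obtain ⟨u, v, h, hx⟩ := exists_edge hG hab x
  rcases le_total (x.coord v) (1 / 2) with h2 | h2
  · exact ⟨u, v, h, hx, h2⟩
  · exact ⟨v, u, h.symm, by linarith, by linarith⟩

theorem mem_subdivVertices_or_openEdge (ε : ℝ) (x : Realization G) :
    x ∈ subdivVertices G ε ∨ ∃ u v α β, G.Adj u v ∧ IsGap ε α β ∧ x ∈ openEdge G u v α β := by
  obtain ⟨u, v, rfl | h, hx⟩ := x.face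
  · left
    rw [eq_vertexPt x fun w h => hx w h h]
    exact vertexPt_mem_subdivVertices ε u
  · by_cases hv : x.coord v ∈ cutSet ε
    · exact Or.inl (mem_subdivVertices_of_add h (x.coord_add_eq_one h.ne hx) hv)
    right
    have hs := x.coord_add_eq_one h.ne hx
    rcases le_total (x.coord v) (1 / 2) with h2 | h2
    · obtain ⟨α, β, hg, hm⟩ := exists_gap (x.nonneg v) h2 hv
      exact ⟨u, v, α, β, h, hg, hs, hm⟩
    · have hu : x.coord u ∉ cutSet ε := fun hu => hv (by
        rw [show x.coord v = 1 - x.coord u by linarith]; exact one_sub_mem_cutSet hu)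
      obtain ⟨α, β, hg, hm⟩ := exists_gap (x.nonneg u) (by linarith) hu
      exact ⟨v, u, α, β, h.symm, hg, by linarith, hm⟩

theorem IsGap.notMem_subdivVertices {ε α β : ℝ} (hg : IsGap ε α β) {u v : V}
    {x : Realization G} (hx : x ∈ openEdge G u v α β) : x ∉ subdivVertices G ε :=
  fun h => hg.gap _ (h v) hx.2

/-- The nearer end `u` is the only vertex with coordinate above 1/2, and `v` is the only other
vertex with nonzero coordinate. -/
theorem IsGap.openEdge_unique {ε α β α' β' : ℝ} (hg : IsGap ε α β) (hg' : IsGap ε α' β')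
    {u v u' v' : V} (h : G.Adj u v) {x : Realization G}
    (hx : x ∈ openEdge G u v α β) (hx' : x ∈ openEdge G u' v' α' β') :
    u = u' ∧ v = v' ∧ α = α' ∧ β = β' := by
  obtain ⟨hs, hxg⟩ := hx
  obtain ⟨hs', hxg'⟩ := hx'
  have h1 := hxg.2.trans_le hg.le_half
  have h2 := hxg'.2.trans_le hg'.le_half
  have key : u = u' := by
    by_contra hne
    have := x.coord_add_le_one hne
    linarith
  subst key
  have key : v = v' := by
    by_contra hne
    have h3 := x.coord_eq_zero h.ne hs (w := v') (fun h4 => by rw [h4] at hs' h2; linarith)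
      (Ne.symm hne)
    linarith [hxg'.1, hg'.nonneg]
  subst key
  exact ⟨rfl, rfl, hg.unique hg' hxg hxg'⟩

theorem subdivEdges_unique {ε : ℝ} {e e' : Set (Realization G)} (he : e ∈ subdivEdges G ε)
    (he' : e' ∈ subdivEdges G ε) {x : Realization G} (hx : x ∈ e) (hx' : x ∈ e') : e = e' := by
  obtain ⟨u, v, α, β, h, hg, rfl⟩ := mem_subdivEdges_iff.1 he
  obtain ⟨u', v', α', β', h', hg', rfl⟩ := mem_subdivEdges_iff.1 he'
  obtain ⟨rfl, rfl, rfl, rfl⟩ := hg.openEdge_unique hg' h hx hx'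
  rfl

theorem notMem_subdivVertices_of_mem {ε : ℝ} {e : Set (Realization G)}
    (he : e ∈ subdivEdges G ε) {x : Realization G} (hx : x ∈ e) : x ∉ subdivVertices G ε := by
  obtain ⟨u, v, α, β, h, hg, rfl⟩ := mem_subdivEdges_iff.1 he
  exact hg.notMem_subdivVertices hx

theorem finite_subdivVertices (ε : ℝ) : (subdivVertices G ε).Finite := by
  have h : (Set.univ.pi fun _ : V => cutSet ε).Finite := Set.Finite.pi fun _ => cutSet_finite ε
  refine Set.Finite.of_finite_image (f := Realization.coord)
    (h.subset ?_) fun x _ y _ hxy => Realization.ext hxy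
  rintro _ ⟨x, hx, rfl⟩ v -
  exact hx v

theorem finite_subdivEdges (ε : ℝ) : (subdivEdges G ε).Finite := by
  have hc := cutSet_finite ε
  have h : ((univ : Set (V × V)) ×ˢ (cutSet ε ×ˢ cutSet ε)).Finite :=
    (Set.toFinite _).prod (hc.prod hc)
  refine (h.image fun p => openEdge G p.1.1 p.1.2 p.2.1 p.2.2).subset ?_
  intro e he
  obtain ⟨u, v, α, β, h, hg, rfl⟩ := mem_subdivEdges_iff.1 he
  exact ⟨((u, v), (α, β)), ⟨mem_univ _, hg.left_mem, hg.right_mem⟩, rfl⟩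

/-- The point of the edge `uv` at distance `s` from `u` (clipped to the edge). -/
noncomputable def edgeMap {u v : V} (h : G.Adj u v) (s : ℝ) : Realization G :=
  edgePt u v h (projIcc 0 1 zero_le_one (1 - s))

theorem edgeMap_add {u v : V} (h : G.Adj u v) (s : ℝ) :
    (edgeMap h s).coord u + (edgeMap h s).coord v = 1 := by
  simp [edgeMap, edgePt, h.ne, h.ne']

theorem edgeMap_coord {u v : V} (h : G.Adj u v) {s : ℝ} (hs : s ∈ Icc (0 : ℝ) 1) :
    (edgeMap h s).coord v = s := by
  have : 1 - s ∈ Icc (0 : ℝ) 1 := ⟨by linarith [hs.2], by linarith [hs.1]⟩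
  simp [edgeMap, edgePt, h.ne', projIcc_of_mem _ this]

theorem eq_edgeMap {u v : V} (h : G.Adj u v) {x : Realization G}
    (hx : x.coord u + x.coord v = 1) : edgeMap h (x.coord v) = x :=
  Realization.ext_of_add h (edgeMap_add h _) hx
    (edgeMap_coord h ⟨x.nonneg v, x.coord_le_one v⟩)

theorem IsGap.Ioo_subset {ε α β : ℝ} (hg : IsGap ε α β) : Ioo α β ⊆ Icc 0 1 := fun s hs =>
  ⟨hg.nonneg.trans hs.1.le, by linarith [hs.2, hg.le_half]⟩

theorem IsGap.image_edgeMap {ε α β : ℝ} (hg : IsGap ε α β) {u v : V} (h : G.Adj u v) :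
    edgeMap h '' Ioo α β = openEdge G u v α β := by
  ext x
  constructor
  · rintro ⟨s, hs, rfl⟩
    exact ⟨edgeMap_add h s, by rwa [edgeMap_coord h (hg.Ioo_subset hs)]⟩
  · rintro ⟨hx, hs⟩
    exact ⟨_, hs, eq_edgeMap h hx⟩

/-! ### Cutting a path at a prescribed length. -/

theorem OnCommonEdge.split {x y : Realization G} (h : OnCommonEdge x y) {t : ℝ} (h0 : 0 ≤ t)
    (h1 : t ≤ dist x.coord y.coord) : ∃ z, IsPathLength x z t ∧
      IsPathLength z y (dist x.coord y.coord - t) := by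
  -- Separating t = 0 makes the length `d` of the segment positive, so that one can divide by it.
  rcases h0.eq_or_lt with rfl | h0
  · exact ⟨x, .refl x, by simpa using h.isPathLength⟩
  obtain ⟨u, v, rfl | huv, hs⟩ := h
  · have hx := eq_vertexPt x fun w h => (hs w h h).1
    have hy := eq_vertexPt y fun w h => (hs w h h).2
    rw [hx, hy, dist_self] at h1
    linarith
  have hx := x.coord_add_eq_one huv.ne fun w h1 h2 => (hs w h1 h2).1
  have hy := y.coord_add_eq_one huv.ne fun w h1 h2 => (hs w h1 h2).2
  have hd := dist_coord_of_add huv hx hy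
  set d := dist x.coord y.coord with hd'
  have hd0 : 0 < d := h0.trans_le h1
  have hr0 : 0 ≤ t / d := by positivity
  have hr1 : t / d ≤ 1 := (div_le_one hd0).2 h1
  have hx0 := x.nonneg v
  have hy0 := y.nonneg v
  have hx1 := x.coord_le_one v
  have hy1 := y.coord_le_one v
  obtain ⟨z, hz, hzv⟩ := exists_point huv (s := (1 - t / d) * x.coord v + t / d * y.coord v)
    (by have := sub_nonneg.2 hr1; positivity) (by nlinarith)
  have e1 : dist x.coord z.coord = t := by
    rw [dist_coord_of_add huv hx hz, hzv, show x.coord v - ((1 - t / d) * x.coord v +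
      t / d * y.coord v) = t / d * (x.coord v - y.coord v) by ring, abs_mul, ← hd,
      abs_of_nonneg hr0, div_mul_cancel₀ _ hd0.ne']
  have e2 : dist z.coord y.coord = d - t := by
    rw [dist_coord_of_add huv hz hy, hzv, show (1 - t / d) * x.coord v +
      t / d * y.coord v - y.coord v = (1 - t / d) * (x.coord v - y.coord v) by ring, abs_mul, ← hd,
      abs_of_nonneg (sub_nonneg.2 hr1), sub_mul, div_mul_cancel₀ _ hd0.ne', one_mul]
  exact ⟨z, e1 ▸ (onCommonEdge_of_add huv hx hz).isPathLength,
    e2 ▸ (onCommonEdge_of_add huv hz hy).isPathLength⟩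

theorem IsPathLength.split {x y : Realization G} {l : ℝ} (h : IsPathLength x y l) {t : ℝ}
    (h0 : 0 ≤ t) (h1 : t ≤ l) : ∃ z, IsPathLength x z t ∧ IsPathLength z y (l - t) := by
  induction h generalizing t with
  | refl x =>
    obtain rfl : t = 0 := le_antisymm h1 h0
    exact ⟨x, .refl x, by simpa using IsPathLength.refl x⟩
  | cons x y z l h hl ih =>
    rcases le_total t (dist x.coord y.coord) with ht | ht
    · obtain ⟨w, hw, hw'⟩ := h.split h0 ht
      refine ⟨w, hw, ?_⟩
      rw [add_sub_right_comm]
      exact hw'.trans hl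
    · obtain ⟨w, hw, hw'⟩ := ih (sub_nonneg.2 ht) (by linarith)
      refine ⟨w, ?_, ?_⟩
      · simpa using IsPathLength.cons _ _ _ _ h hw
      · rwa [sub_sub_eq_add_sub, add_comm l] at hw'

section Metric

variable [hG : Fact G.Connected]

theorem continuous_edgeMap {u v : V} (h : G.Adj u v) : Continuous (edgeMap h) :=
  (continuous_edgePt u v h).comp (continuous_projIcc.comp (continuous_const.sub continuous_id))

/-- Two open edges at the same positions are isometric. -/
noncomputable def openEdgeIso {ε α β : ℝ} (hg : IsGap ε α β) {u v u' v' : V} (h : G.Adj u v)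
    (h' : G.Adj u' v') : openEdge G u v α β ≃ᵢ openEdge G u' v' α β where
  toFun y := ⟨edgeMap h' (y.1.coord v), edgeMap_add _ _, by
    rw [edgeMap_coord h' (hg.Ioo_subset y.2.2)]; exact y.2.2⟩
  invFun y := ⟨edgeMap h (y.1.coord v'), edgeMap_add _ _, by
    rw [edgeMap_coord h (hg.Ioo_subset y.2.2)]; exact y.2.2⟩
  left_inv y := by
    refine Subtype.ext ?_
    dsimp only
    rw [edgeMap_coord h' (hg.Ioo_subset y.2.2)]
    exact eq_edgeMap h y.2.1
  right_inv y := by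
    refine Subtype.ext ?_
    dsimp only
    rw [edgeMap_coord h (hg.Ioo_subset y.2.2)]
    exact eq_edgeMap h' y.2.1
  isometry_toFun := by
    refine Isometry.of_dist_eq fun y z => ?_
    rw [Subtype.dist_eq, Subtype.dist_eq, dist_of_add h' (edgeMap_add _ _) (edgeMap_add _ _),
      dist_of_add h y.2.1 z.2.1, edgeMap_coord h' (hg.Ioo_subset y.2.2),
      edgeMap_coord h' (hg.Ioo_subset z.2.2)]

theorem openEdgeIso_coord {ε α β : ℝ} (hg : IsGap ε α β) {u v u' v' : V} (h : G.Adj u v)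
    (h' : G.Adj u' v') (y : openEdge G u v α β) :
    (openEdgeIso hg h h' y).1.coord v' = y.1.coord v :=
  edgeMap_coord h' (hg.Ioo_subset y.2.2)

/-! ### The quotient map -/

variable {ε : ℝ}

theorem toQuot_eq_iff {x y : Realization G} :
    toQuot G ε x = toQuot G ε y ↔ closedBall x ε = closedBall y ε :=
  Quotient.eq (r := ballSetoid G ε)

theorem continuous_toQuot : Continuous (toQuot G ε) := continuous_quotient_mk'

theorem surjective_toQuot : Function.Surjective (toQuot G ε) := Quotient.mk_surjective

/-- For each `p` the closed ball about `p` contains `e` by stability, hence also the closure of `e`.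
-/
theorem ball_eq_univ_of_mem {e : Set (Realization G)} (he : e ∈ subdivEdges G ε)
    {x y : Realization G} (hx : x ∈ e) (hB : closedBall x ε = univ) (hy : y ∈ closure e) :
    closedBall y ε = univ := by
  obtain ⟨u, v, α, β, h, hg, rfl⟩ := mem_subdivEdges_iff.1 he
  refine eq_univ_of_forall fun p => ?_
  rw [mem_closedBall, dist_comm, ← mem_closedBall]
  refine closure_minimal (fun z hz => ?_) isClosed_closedBall hy
  rw [mem_closedBall, dist_comm, ← mem_closedBall,
    hg.ball_eq_univ h hx.1 hz.1 hx.2 hz.2 hB]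
  trivial

theorem exists_vertex_mem_closure {e : Set (Realization G)} (he : e ∈ subdivEdges G ε) :
    ∃ w ∈ subdivVertices G ε, w ∈ closure e := by
  obtain ⟨u, v, α, β, h, hg, rfl⟩ := mem_subdivEdges_iff.1 he
  refine ⟨edgeMap h α, mem_subdivVertices_of_add h (edgeMap_add h α) ?_, ?_⟩
  · rw [edgeMap_coord h (cutSet_subset_Icc ε hg.left_mem)]
    exact hg.left_mem
  · rw [← hg.image_edgeMap h]
    refine image_closure_subset_closure_image (continuous_edgeMap h) ⟨α, ?_, rfl⟩
    rw [closure_Ioo hg.lt.ne]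
    exact left_mem_Icc.2 hg.lt.le

theorem collapsed_edge {e : Set (Realization G)} (he : e ∈ subdivEdges G ε)
    {x : Realization G} (hx : x ∈ e) (hB : closedBall x ε = univ) :
    ∃ v ∈ subdivVertices G ε, toQuot G ε '' closure e = {toQuot G ε v} := by
  obtain ⟨w, hw, hwe⟩ := exists_vertex_mem_closure he
  refine ⟨w, hw, ?_⟩
  rw [eq_singleton_iff_unique_mem]
  refine ⟨⟨w, hwe, rfl⟩, ?_⟩
  rintro _ ⟨y, hy, rfl⟩
  rw [toQuot_eq_iff, ball_eq_univ_of_mem he hx hB hy, ball_eq_univ_of_mem he hx hB hwe]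

theorem exists_edge_identification (hε : 0 ≤ ε) {e : Set (Realization G)}
    (he : e ∈ subdivEdges G ε) {x : Realization G} (hx : x ∈ e) (hB : closedBall x ε ≠ univ)
    {x' : Realization G} (hne : x' ≠ x) (hq : toQuot G ε x' = toQuot G ε x) :
    ∃ e' ∈ subdivEdges G ε, e' ≠ e ∧ ∃ h : e ≃ᵢ e',
      (∀ y : e, toQuot G ε (h y) = toQuot G ε y) ∧ x' = h ⟨x, hx⟩ := by
  obtain ⟨u, v, α, β, h, hg, rfl⟩ := mem_subdivEdges_iff.1 he
  obtain ⟨u', v', h', hx', hx2⟩ := exists_half_edge hG.out h x'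
  obtain ⟨hs, H⟩ := hg.identified hε h h' hx.1 hx' hx.2 hx2 (toQuot_eq_iff.1 hq).symm hne hB
  have hmem : x' ∈ openEdge G u' v' α β := ⟨hx', hs ▸ hx.2⟩
  refine ⟨openEdge G u' v' α β, mem_subdivEdges_iff.2 ⟨u', v', α, β, h', hg, rfl⟩, ?_,
    openEdgeIso hg h h', fun y => ?_, ?_⟩
  · intro heq
    obtain ⟨rfl, rfl, -, -⟩ := hg.openEdge_unique hg h' hmem (heq ▸ hmem)
    exact hne (Realization.ext_of_add h hx' hx.1 hs)
  · rw [toQuot_eq_iff]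
    exact (H y _ y.2.1 (openEdgeIso hg h h' y).2.1 y.2.2 (openEdgeIso_coord hg h h' y)).symm
  · refine Realization.ext_of_add h' hx' (openEdgeIso hg h h' _).2.1 ?_
    rw [openEdgeIso_coord hg h h', hs]

/-- Otherwise `x'` lies in an open edge, and `exists_edge_identification` applied at `x'` places `v`
in an open edge as well. -/
theorem mem_subdivVertices_of_toQuot_eq (hε : 0 ≤ ε) {v : Realization G}
    (hv : v ∈ subdivVertices G ε) (hB : closedBall v ε ≠ univ) {x' : Realization G}
    (hq : toQuot G ε x' = toQuot G ε v) : x' ∈ subdivVertices G ε := by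
  by_contra hx'
  obtain ⟨a, b, α, β, h, hg, hm⟩ := (mem_subdivVertices_or_openEdge ε x').resolve_left hx'
  have hB' : closedBall x' ε ≠ univ := by rwa [toQuot_eq_iff.1 hq]
  obtain ⟨e', he', -, i, -, hi⟩ := exists_edge_identification hε
    (mem_subdivEdges_iff.2 ⟨a, b, α, β, h, hg, rfl⟩) hm hB' (x' := v)
    (fun hvx => hx' (hvx ▸ hv)) hq.symm
  exact notMem_subdivVertices_of_mem he' (hi ▸ (i ⟨x', hm⟩).2) hv

theorem injOn_toQuot (hε : 0 ≤ ε) {e : Set (Realization G)} (he : e ∈ subdivEdges G ε)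
    (hB : ∃ x ∈ e, closedBall x ε ≠ univ) : InjOn (toQuot G ε) e := by
  intro y hy z hz hyz
  by_contra hne
  obtain ⟨x, hx, hB⟩ := hB
  have hBy : closedBall y ε ≠ univ := fun h =>
    hB (ball_eq_univ_of_mem he hy h (subset_closure hx))
  obtain ⟨e', he', hne', i, -, hi⟩ := exists_edge_identification hε he hy hBy (Ne.symm hne) hyz.symm
  exact hne' (subdivEdges_unique he' he (hi ▸ (i ⟨y, hy⟩).2) hz)

/-! ### The hyperspace of balls -/

/-- Uses the length metric: a path from `y` to `p` shorter than ε + r is cut at length ε. This makes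
the ball map 1-Lipschitz. -/
theorem exists_mem_ball_near (hε : 0 ≤ ε) {x y p : Realization G} (hp : p ∈ closedBall x ε) {r : ℝ}
    (hr : dist x y < r) : ∃ q ∈ closedBall y ε, dist p q ≤ r := by
  have h1 : dist y p < ε + r := by
    have := dist_triangle y x p
    rw [mem_closedBall, dist_comm] at hp
    rw [dist_comm y x] at this
    linarith
  obtain ⟨l, hl, hlp⟩ := exists_isPathLength_lt h1
  rcases le_total l ε with hle | hle
  · refine ⟨p, ?_, by simpa using dist_nonneg.trans hr.le⟩
    rw [mem_closedBall, dist_comm]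
    exact (dist_le_of_isPathLength hlp).trans hle
  · obtain ⟨q, hq, hqp⟩ := hlp.split hε hle
    refine ⟨q, ?_, ?_⟩
    · rw [mem_closedBall, dist_comm]
      exact dist_le_of_isPathLength hq
    · rw [dist_comm]
      exact (dist_le_of_isPathLength hqp).trans (by linarith)

theorem continuous_ballMap (hε : 0 ≤ ε) : Continuous (ballMap G ε hε) := by
  refine (LipschitzWith.of_dist_le_mul (K := 1) fun x y => ?_).continuous
  rw [NNReal.coe_one, one_mul]
  refine le_of_forall_gt_imp_ge_of_dense fun r hr => ?_
  rw [NonemptyCompacts.dist_eq]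
  exact hausdorffDist_le_of_mem_dist (dist_nonneg.trans hr.le)
    (fun p hp => exists_mem_ball_near hε hp hr)
    (fun p hp => exists_mem_ball_near hε hp (by rwa [dist_comm]))

theorem ballMap_eq_iff (hε : 0 ≤ ε) {x y : Realization G} :
    ballMap G ε hε x = ballMap G ε hε y ↔ closedBall x ε = closedBall y ε := by
  rw [← SetLike.coe_set_eq]
  rfl

/-- A continuous bijection from a compact space to a Hausdorff space. -/
theorem exists_homeomorph_range_ballMap (hε : 0 ≤ ε) :
    ∃ Φ : BallQuotient G ε ≃ₜ Set.range (ballMap G ε hε),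
      ∀ x, (Φ (toQuot G ε x) : TopologicalSpace.NonemptyCompacts (Realization G)) =
        ballMap G ε hε x := by
  let f : BallQuotient G ε → Set.range (ballMap G ε hε) :=
    Quotient.lift (fun x => ⟨ballMap G ε hε x, x, rfl⟩)
      fun _ _ h => Subtype.ext ((ballMap_eq_iff hε).2 h)
  have hf : Continuous f := ((continuous_ballMap hε).subtype_mk _).quotient_lift _
  have hb : Function.Bijective f := by
    constructor
    · intro q r
      obtain ⟨x, rfl⟩ := surjective_toQuot q
      obtain ⟨y, rfl⟩ := surjective_toQuot r
      intro h
      exact toQuot_eq_iff.2 ((ballMap_eq_iff hε).1 (congrArg Subtype.val h))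
    · rintro ⟨_, x, rfl⟩
      exact ⟨toQuot G ε x, rfl⟩
  exact ⟨Continuous.homeoOfEquivCompactToT2 (f := Equiv.ofBijective f hb) hf, fun x => rfl⟩

/-! ### The graph structure -/

/-- Hausdorffness is inherited from the hyperspace. Edges with full balls collapse into vertex
classes. If two remaining edge images meet, either the edges agree or the isometry through the
common class matches the whole images. -/
theorem isGraphStructure_quotient (hε : 0 ≤ ε) : IsGraphStructure (toQuot G ε '' subdivVertices G ε)
    {q | ∃ e ∈ subdivEdges G ε, (∃ x ∈ e, Metric.closedBall x ε ≠ Set.univ) ∧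
      q = toQuot G ε '' e} where
  t2 := by
    obtain ⟨Φ, -⟩ := exists_homeomorph_range_ballMap (G := G) hε
    exact Φ.isEmbedding.t2Space
  finite_vertices := (finite_subdivVertices ε).image _
  finite_edges := by
    refine ((finite_subdivEdges (G := G) ε).image fun e => toQuot G ε '' e).subset ?_
    rintro _ ⟨e, he, -, rfl⟩
    exact ⟨e, he, rfl⟩
  cover := by
    refine eq_univ_of_forall fun q => ?_
    obtain ⟨x, rfl⟩ := surjective_toQuot q
    rcases mem_subdivVertices_or_openEdge ε x with hx | ⟨u, v, α, β, h, hg, hx⟩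
    · exact Or.inl ⟨x, hx, rfl⟩
    have he : openEdge G u v α β ∈ subdivEdges G ε :=
      mem_subdivEdges_iff.2 ⟨u, v, α, β, h, hg, rfl⟩
    by_cases hB : closedBall x ε = univ
    · obtain ⟨w, hw, heq⟩ := collapsed_edge he hx hB
      have : toQuot G ε x ∈ toQuot G ε '' closure (openEdge G u v α β) :=
        ⟨x, subset_closure hx, rfl⟩
      rw [heq] at this
      exact Or.inl ⟨w, hw, this.symm⟩
    · exact Or.inr ⟨_, ⟨_, he, ⟨x, hx, hB⟩, rfl⟩, x, hx, rfl⟩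
  disjoint_vertices := by
    rintro _ ⟨e, he, ⟨x, hx, hB⟩, rfl⟩
    rw [Set.disjoint_left]
    rintro _ ⟨v, hv, rfl⟩ ⟨y, hy, hyv⟩
    have hBy : closedBall y ε ≠ univ := fun h =>
      hB (ball_eq_univ_of_mem he hy h (subset_closure hx))
    rw [toQuot_eq_iff.1 hyv] at hBy
    exact notMem_subdivVertices_of_mem he hy (mem_subdivVertices_of_toQuot_eq hε hv hBy hyv)
  disjoint_edges := by
    rintro _ ⟨e, he, ⟨x, hx, hB⟩, rfl⟩ _ ⟨f, hf, -, rfl⟩ hne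
    refine Set.disjoint_left.2 ?_
    rintro _ ⟨y, hy, rfl⟩ ⟨z, hz, hzy⟩
    refine hne ?_
    by_cases hyz : z = y
    · subst hyz
      rw [subdivEdges_unique he hf hy hz]
    have hBy : closedBall y ε ≠ univ := fun h =>
      hB (ball_eq_univ_of_mem he hy h (subset_closure hx))
    obtain ⟨e', he', -, i, hi, hiz⟩ := exists_edge_identification hε he hy hBy hyz hzy
    obtain rfl := subdivEdges_unique he' hf (hiz ▸ (i ⟨y, hy⟩).2) hz
    ext q
    constructor
    · rintro ⟨w, hw, rfl⟩
      exact ⟨_, (i ⟨w, hw⟩).2, hi ⟨w, hw⟩⟩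
    · rintro ⟨w, hw, rfl⟩
      refine ⟨_, (i.symm ⟨w, hw⟩).2, ?_⟩
      rw [← hi, i.apply_symm_apply]
  param := by
    rintro _ ⟨e, he, hB, rfl⟩
    have hinj := injOn_toQuot hε he hB
    obtain ⟨u, v, α, β, h, hg, rfl⟩ := mem_subdivEdges_iff.1 he
    have hlt := sub_pos.2 hg.lt
    have himg : (fun t : ℝ => α + t * (β - α)) '' Ioo 0 1 = Ioo α β := by
      ext s
      constructor
      · rintro ⟨t, ⟨h0, h1⟩, rfl⟩
        constructor <;> dsimp only <;> nlinarith
      · rintro ⟨h0, h1⟩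
        refine ⟨(s - α) / (β - α), ⟨div_pos (by linarith) hlt, (div_lt_one hlt).2 (by linarith)⟩, ?_⟩
        dsimp only
        rw [div_mul_cancel₀ _ hlt.ne']
        ring
    refine ⟨fun t => toQuot G ε (edgeMap h (α + t * (β - α))), ?_, ?_, ?_, ?_, ?_⟩
    · exact (continuous_toQuot.comp ((continuous_edgeMap h).comp (by fun_prop))).continuousOn
    · refine ⟨_, mem_subdivVertices_of_add h (edgeMap_add h _) ?_, rfl⟩
      rw [zero_mul, add_zero, edgeMap_coord h (cutSet_subset_Icc ε hg.left_mem)]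
      exact hg.left_mem
    · refine ⟨_, mem_subdivVertices_of_add h (edgeMap_add h _) ?_, rfl⟩
      rw [one_mul, add_sub_cancel, edgeMap_coord h (cutSet_subset_Icc ε hg.right_mem)]
      exact hg.right_mem
    · intro s hs t ht hst
      have hs' : α + s * (β - α) ∈ Ioo α β := himg ▸ mem_image_of_mem _ hs
      have ht' : α + t * (β - α) ∈ Ioo α β := himg ▸ mem_image_of_mem _ ht
      have heq := hinj (hg.image_edgeMap h ▸ mem_image_of_mem (edgeMap h) hs')
        (hg.image_edgeMap h ▸ mem_image_of_mem (edgeMap h) ht') hst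
      have := congrArg (fun x : Realization G => x.coord v) heq
      rw [edgeMap_coord h (hg.Ioo_subset hs'), edgeMap_coord h (hg.Ioo_subset ht')] at this
      exact mul_right_cancel₀ hlt.ne' (add_left_cancel this)
    · rw [← hg.image_edgeMap h, ← himg, image_image, image_image]

/-! ### Connectedness -/

theorem OnCommonEdge.connectedComponent_eq {x y : Realization G} (h : OnCommonEdge x y) :
    connectedComponent x = connectedComponent y := by
  obtain ⟨u, v, rfl | huv, hs⟩ := h
  · rw [eq_vertexPt x fun w h => (hs w h h).1, eq_vertexPt y fun w h => (hs w h h).2]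
  · obtain ⟨s, rfl⟩ := eq_edgePt huv x fun w h1 h2 => (hs w h1 h2).1
    obtain ⟨t, rfl⟩ := eq_edgePt huv y fun w h1 h2 => (hs w h1 h2).2
    exact _root_.connectedComponent_eq ((isPreconnected_range
      (continuous_edgePt u v huv)).subset_connectedComponent (mem_range_self s) (mem_range_self t))

theorem IsPathLength.connectedComponent_eq {x y : Realization G} {l : ℝ}
    (h : IsPathLength x y l) : connectedComponent x = connectedComponent y := by
  induction h with
  | refl x => rfl
  | cons x y z l h hl ih => exact h.connectedComponent_eq.trans ih

instance : ConnectedSpace (Realization G) := by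
  obtain ⟨v⟩ := hG.out.nonempty
  refine connectedSpace_iff_connectedComponent.2 ⟨vertexPt G v, eq_univ_of_forall fun x => ?_⟩
  obtain ⟨l, hl⟩ := exists_isPathLength hG.out (vertexPt G v) x
  rw [hl.connectedComponent_eq]
  exact mem_connectedComponent

end Metric

end FiniteMetricGraph

namespace FiniteMetricGraph

/-! ### Spaces glued from arcs -/

section ArcSystem

variable {A E Y Y' : Type*} {src tgt : E → A}

/-- The points `pt a` and the arcs `γ e`, from `pt (src e)` to `pt (tgt e)`, form a graph structure
on `Y`, in parametrized form. -/
structure IsArcSystem [TopologicalSpace Y] (src tgt : E → A) (pt : A → Y) (γ : E → ℝ → Y) :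
    Prop where
  cont : ∀ e, ContinuousOn (γ e) (Icc 0 1)
  zero : ∀ e, γ e 0 = pt (src e)
  one : ∀ e, γ e 1 = pt (tgt e)
  pt_injective : Function.Injective pt
  ne_pt : ∀ e, ∀ t ∈ Ioo (0 : ℝ) 1, ∀ a, γ e t ≠ pt a
  injective : ∀ e, ∀ t ∈ Ioo (0 : ℝ) 1, ∀ e', ∀ t' ∈ Ioo (0 : ℝ) 1, γ e t = γ e' t' →
    e = e' ∧ t = t'
  surjective : ∀ y, (∃ a, y = pt a) ∨ ∃ e, ∃ t ∈ Icc (0 : ℝ) 1, y = γ e t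

/-- The map from the disjoint union of the points and the closed arcs. -/
def arcMap (pt : A → Y) (γ : E → ℝ → Y) : A ⊕ (Σ _ : E, Icc (0 : ℝ) 1) → Y :=
  Sum.elim pt fun x => γ x.1 x.2

variable [TopologicalSpace Y] [TopologicalSpace Y'] {pt : A → Y} {γ : E → ℝ → Y}
  {pt' : A → Y'} {γ' : E → ℝ → Y'}

theorem IsArcSystem.surjective_arcMap (h : IsArcSystem src tgt pt γ) :
    Function.Surjective (arcMap pt γ) := by
  intro y
  rcases h.surjective y with ⟨a, rfl⟩ | ⟨e, t, ht, rfl⟩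
  · exact ⟨Sum.inl a, rfl⟩
  · exact ⟨Sum.inr ⟨e, t, ht⟩, rfl⟩

theorem IsArcSystem.continuous_arcMap [TopologicalSpace A] [DiscreteTopology A]
    (h : IsArcSystem src tgt pt γ) : Continuous (arcMap pt γ) :=
  continuous_of_discreteTopology.sumElim
    (continuous_sigma fun e => continuousOn_iff_continuous_domRestrict.1 (h.cont e))

/-- A continuous map from a compact space to a Hausdorff space is closed. -/
theorem IsArcSystem.isQuotientMap_arcMap [T2Space Y] [Finite A] [Finite E] [TopologicalSpace A]
    [DiscreteTopology A] (h : IsArcSystem src tgt pt γ) :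
    Topology.IsQuotientMap (arcMap pt γ) :=
  h.continuous_arcMap.isClosedMap.isQuotientMap h.continuous_arcMap h.surjective_arcMap

theorem IsArcSystem.normal_form (h : IsArcSystem src tgt pt γ) (h' : IsArcSystem src tgt pt' γ')
    (z : A ⊕ (Σ _ : E, Icc (0 : ℝ) 1)) :
    (∃ a, arcMap pt γ z = pt a ∧ arcMap pt' γ' z = pt' a) ∨
      ∃ e, ∃ t ∈ Ioo (0 : ℝ) 1, arcMap pt γ z = γ e t ∧ arcMap pt' γ' z = γ' e t := by
  rcases z with a | ⟨e, t, ht⟩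
  · exact Or.inl ⟨a, rfl, rfl⟩
  rcases ht.1.eq_or_lt with rfl | h0
  · exact Or.inl ⟨src e, h.zero e, h'.zero e⟩
  rcases ht.2.eq_or_lt with rfl | h1
  · exact Or.inl ⟨tgt e, h.one e, h'.one e⟩
  · exact Or.inr ⟨e, t, ⟨h0, h1⟩, rfl, rfl⟩

/-- Once the ends of arcs are replaced by points, only formally equal parameters have equal images,
so the gluing depends on `src` and `tgt` alone. -/
theorem IsArcSystem.ker_le (h : IsArcSystem src tgt pt γ) (h' : IsArcSystem src tgt pt' γ')
    {z w : A ⊕ (Σ _ : E, Icc (0 : ℝ) 1)} (hzw : arcMap pt γ z = arcMap pt γ w) :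
    arcMap pt' γ' z = arcMap pt' γ' w := by
  rcases h.normal_form h' z with ⟨a, h1, h2⟩ | ⟨e, t, ht, h1, h2⟩ <;>
    rcases h.normal_form h' w with ⟨b, k1, k2⟩ | ⟨f, s, hs, k1, k2⟩ <;>
    rw [h1, k1] at hzw <;> rw [h2, k2]
  · rw [h.pt_injective hzw]
  · exact absurd hzw.symm (h.ne_pt f s hs a)
  · exact absurd hzw (h.ne_pt e t ht b)
  · obtain ⟨rfl, rfl⟩ := h.injective e t ht f s hs hzw
    rfl

/-- Two Hausdorff spaces with arc systems of the same combinatorial type are homeomorphic. -/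
theorem IsArcSystem.nonempty_homeomorph [T2Space Y] [T2Space Y'] [Finite A] [Finite E]
    (h : IsArcSystem src tgt pt γ) (h' : IsArcSystem src tgt pt' γ') : Nonempty (Y ≃ₜ Y') := by
  let _ : TopologicalSpace A := ⊥
  have : DiscreteTopology A := ⟨rfl⟩
  have hker : Setoid.ker (arcMap pt γ) = Setoid.ker (arcMap pt' γ') :=
    Setoid.ext fun z w => ⟨h.ker_le h', h'.ker_le h⟩
  let f : C(A ⊕ (Σ _ : E, Icc (0 : ℝ) 1), Y) := ⟨_, h.continuous_arcMap⟩
  let f' : C(A ⊕ (Σ _ : E, Icc (0 : ℝ) 1), Y') := ⟨_, h'.continuous_arcMap⟩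
  have hq : Topology.IsQuotientMap f := h.isQuotientMap_arcMap
  have hq' : Topology.IsQuotientMap f' := h'.isQuotientMap_arcMap
  have k : Nonempty (Quotient (Setoid.ker f) ≃ₜ Y') := by
    rw [show Setoid.ker f = Setoid.ker f' from hker]
    exact ⟨hq'.homeomorph⟩
  exact k.map hq.homeomorph.symm.trans

/-- On a connected space glued from arcs, a property of the points which is inherited along the
arcs in both directions holds at all points or at none. -/
theorem IsArcSystem.forall_of_exists [T2Space Y] [PreconnectedSpace Y] [Finite A] [Finite E]
    (h : IsArcSystem src tgt pt γ) {χ : A → Prop} (hχ : ∀ e, χ (src e) ↔ χ (tgt e))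
    {a : A} (ha : χ a) (b : A) : χ b := by
  let _ : TopologicalSpace A := ⊥
  have : DiscreteTopology A := ⟨rfl⟩
  -- On a whole arc the property takes its value at the source; at parameter 1 this agrees with the
  -- target by `hχ`.
  let χ' : A ⊕ (Σ _ : E, Icc (0 : ℝ) 1) → Prop := Sum.elim χ fun x => χ (src x.1)
  have hfac : ∀ z w, arcMap pt γ z = arcMap pt γ w → χ' z → χ' w := by
    have key : ∀ z, (∃ a, arcMap pt γ z = pt a ∧ (χ' z ↔ χ a)) ∨
        ∃ e, ∃ t ∈ Ioo (0 : ℝ) 1, arcMap pt γ z = γ e t ∧ (χ' z ↔ χ (src e)) := by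
      rintro (a | ⟨e, t, ht⟩)
      · exact Or.inl ⟨a, rfl, Iff.rfl⟩
      rcases ht.1.eq_or_lt with rfl | h0
      · exact Or.inl ⟨src e, h.zero e, Iff.rfl⟩
      rcases ht.2.eq_or_lt with rfl | h1
      · exact Or.inl ⟨tgt e, h.one e, hχ e⟩
      · exact Or.inr ⟨e, t, ⟨h0, h1⟩, rfl, Iff.rfl⟩
    intro z w hzw hz
    rcases key z with ⟨a, h1, h2⟩ | ⟨e, t, ht, h1, h2⟩ <;>
      rcases key w with ⟨b, k1, k2⟩ | ⟨f, s, hs, k1, k2⟩ <;>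
      rw [h1, k1] at hzw <;> rw [h2] at hz <;> rw [k2]
    · rwa [← h.pt_injective hzw]
    · exact absurd hzw.symm (h.ne_pt f s hs a)
    · exact absurd hzw (h.ne_pt e t ht b)
    · obtain ⟨rfl, rfl⟩ := h.injective e t ht f s hs hzw
      exact hz
  have hopen : ∀ p : Prop → Prop, IsOpen {z | p (χ' z)} := fun p =>
    isOpen_sum_iff.2 ⟨isOpen_discrete _, isOpen_sigma_iff.2 fun e =>
      (isOpen_const : IsOpen {_t : Icc (0 : ℝ) 1 | p (χ (src e))})⟩
  -- The clopen set is saturated, so its image under the quotient map is clopen.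
  have hpre : arcMap pt γ ⁻¹' (arcMap pt γ '' {z | χ' z}) = {z | χ' z} := by
    ext z
    exact ⟨fun ⟨w, hw, hwz⟩ => hfac w z hwz hw, fun hz => ⟨z, hz, rfl⟩⟩
  have hclopen : IsClopen (arcMap pt γ '' {z | χ' z}) := by
    have hq := h.isQuotientMap_arcMap
    constructor
    · rw [← hq.isClosed_preimage, hpre]
      exact ⟨hopen Not⟩
    · rw [← hq.isOpen_preimage, hpre]
      exact hopen id
  have huniv := (isClopen_iff.1 hclopen).resolve_left
    (Set.Nonempty.ne_empty ⟨_, Sum.inl a, ha, rfl⟩)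
  obtain ⟨z, hz, hzb⟩ : pt b ∈ arcMap pt γ '' {z | χ' z} := huniv ▸ mem_univ _
  exact hfac z (Sum.inl b) hzb hz

/-! ### The simple graph of an arc system -/

/-- The edges of the simple graph obtained by cutting every arc into three parts. -/
inductive SubdivRel (src tgt : E → A) : A ⊕ E × Bool → A ⊕ E × Bool → Prop
  | start (e : E) : SubdivRel src tgt (Sum.inl (src e)) (Sum.inr (e, false))
  | middle (e : E) : SubdivRel src tgt (Sum.inr (e, false)) (Sum.inr (e, true))
  | finish (e : E) : SubdivRel src tgt (Sum.inr (e, true)) (Sum.inl (tgt e))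

/-- The simple graph obtained by cutting every arc into three parts. -/
def threefoldGraph (src tgt : E → A) : SimpleGraph (A ⊕ E × Bool) :=
  SimpleGraph.fromRel (SubdivRel src tgt)

theorem SubdivRel.adj {x y : A ⊕ E × Bool} (h : SubdivRel src tgt x y) :
    (threefoldGraph src tgt).Adj x y :=
  (SimpleGraph.fromRel_adj _ _ _).2 ⟨by cases h <;> simp, Or.inl h⟩

theorem IsArcSystem.connected_threefoldGraph [T2Space Y] [ConnectedSpace Y] [Finite A] [Finite E]
    (h : IsArcSystem src tgt pt γ) : (threefoldGraph src tgt).Connected := by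
  obtain ⟨y⟩ := ‹ConnectedSpace Y›.toNonempty
  obtain ⟨a⟩ : Nonempty A := by
    rcases h.surjective y with ⟨a, -⟩ | ⟨e, -⟩
    exacts [⟨a⟩, ⟨src e⟩]
  have h1 : ∀ e, (threefoldGraph src tgt).Reachable (Sum.inl (src e)) (Sum.inr (e, false)) :=
    fun e => (SubdivRel.start e).adj.reachable
  have h2 : ∀ e, (threefoldGraph src tgt).Reachable (Sum.inl (src e)) (Sum.inr (e, true)) :=
    fun e => (h1 e).trans (SubdivRel.middle e).adj.reachable
  have h3 : ∀ e, (threefoldGraph src tgt).Reachable (Sum.inl (src e)) (Sum.inl (tgt e)) :=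
    fun e => (h2 e).trans (SubdivRel.finish e).adj.reachable
  have key := h.forall_of_exists
    (χ := fun b => (threefoldGraph src tgt).Reachable (Sum.inl a) (Sum.inl b))
    (fun e => ⟨fun h => h.trans (h3 e), fun h => h.trans (h3 e).symm⟩) (a := a) (.refl _)
  refine SimpleGraph.connected_iff_exists_forall_reachable _ |>.2 ⟨Sum.inl a, ?_⟩
  rintro (b | ⟨e, b⟩)
  · exact key b
  · cases b
    · exact (key (src e)).trans (h1 e)
    · exact (key (src e)).trans (h2 e)

/-! ### The realization of the subdivided graph as an arc system. -/

variable [Fintype A] [Fintype E]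

theorem edgeMap_zero {V : Type*} [Fintype V] {G : SimpleGraph V} {u v : V} (h : G.Adj u v) :
    edgeMap h 0 = vertexPt G u := by
  refine eq_vertexPt_of_coord_eq_one ?_
  have := edgeMap_add h 0
  rw [edgeMap_coord h (by simp)] at this
  linarith

theorem edgeMap_one {V : Type*} [Fintype V] {G : SimpleGraph V} {u v : V} (h : G.Adj u v) :
    edgeMap h 1 = vertexPt G v :=
  eq_vertexPt_of_coord_eq_one (edgeMap_coord h (by simp))

open Classical in
/-- The arc of the realization which replaces `e`. -/
noncomputable def arc (src tgt : E → A) (e : E) (t : ℝ) : Realization (threefoldGraph src tgt) :=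
  if t ≤ 1 / 3 then edgeMap (SubdivRel.start e).adj (3 * t)
  else if t ≤ 2 / 3 then edgeMap (SubdivRel.middle e).adj (3 * t - 1)
  else edgeMap (SubdivRel.finish e).adj (3 * t - 2)

theorem arc_of_le {e : E} {t : ℝ} (h : t ≤ 1 / 3) :
    arc src tgt e t = edgeMap (SubdivRel.start e).adj (3 * t) := if_pos h

theorem arc_of_mem {e : E} {t : ℝ} (h1 : 1 / 3 ≤ t) (h2 : t ≤ 2 / 3) :
    arc src tgt e t = edgeMap (SubdivRel.middle e).adj (3 * t - 1) := by
  rcases h1.eq_or_lt with rfl | h1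
  · rw [arc_of_le le_rfl, show (3 * (1 / 3) : ℝ) = 1 by norm_num, sub_self, edgeMap_one,
      edgeMap_zero]
  · rw [arc, if_neg (not_le.2 h1), if_pos h2]

theorem arc_of_ge {e : E} {t : ℝ} (h1 : 2 / 3 ≤ t) :
    arc src tgt e t = edgeMap (SubdivRel.finish e).adj (3 * t - 2) := by
  rcases h1.eq_or_lt with rfl | h1
  · rw [arc_of_mem (by norm_num) le_rfl, show (3 * (2 / 3) - 1 : ℝ) = 1 by norm_num,
      show (3 * (2 / 3) - 2 : ℝ) = 0 by norm_num, edgeMap_one, edgeMap_zero]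
  · rw [arc, if_neg (by linarith), if_neg (not_le.2 h1)]

theorem continuous_arc [Fact (threefoldGraph src tgt).Connected] (e : E) :
    Continuous (arc src tgt e) := by
  have hc : ∀ c : ℝ, Continuous fun t : ℝ => 3 * t - c := fun c => by fun_prop
  refine Continuous.if_le ((continuous_edgeMap _).comp (by fun_prop))
    (Continuous.if_le ((continuous_edgeMap _).comp (hc 1)) ((continuous_edgeMap _).comp (hc 2))
      continuous_id continuous_const fun t ht => ?_) continuous_id continuous_const fun t ht => ?_
  · exact (arc_of_mem (by linarith) ht.le).symm.trans (arc_of_ge ht.ge)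
  · rw [if_pos (by linarith)]
    exact (arc_of_le ht.le).symm.trans (arc_of_mem ht.ge (by linarith))

theorem arc_zero (e : E) : arc src tgt e 0 = vertexPt _ (Sum.inl (src e)) := by
  rw [arc_of_le (by norm_num), mul_zero, edgeMap_zero]

theorem arc_one (e : E) : arc src tgt e 1 = vertexPt _ (Sum.inl (tgt e)) := by
  rw [arc_of_ge (by norm_num), show (3 * 1 - 2 : ℝ) = 1 by norm_num, edgeMap_one]

/-- The coordinates at the two inner vertices run around the triangle (0,0), (1,0), (0,1), so for t
in (0, 1) they determine t. -/
theorem arc_coord (e : E) {t : ℝ} (ht : t ∈ Icc (0 : ℝ) 1) :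
    (t ≤ 1 / 3 ∧ (arc src tgt e t).coord (Sum.inr (e, false)) = 3 * t ∧
      (arc src tgt e t).coord (Sum.inr (e, true)) = 0) ∨
    (1 / 3 ≤ t ∧ t ≤ 2 / 3 ∧ (arc src tgt e t).coord (Sum.inr (e, false)) = 2 - 3 * t ∧
      (arc src tgt e t).coord (Sum.inr (e, true)) = 3 * t - 1) ∨
    (2 / 3 ≤ t ∧ (arc src tgt e t).coord (Sum.inr (e, false)) = 0 ∧
      (arc src tgt e t).coord (Sum.inr (e, true)) = 3 - 3 * t) := by
  obtain ⟨h0, h1⟩ := ht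
  rcases le_total t (1 / 3) with h | h
  · left
    rw [arc_of_le h]
    exact ⟨h, edgeMap_coord _ ⟨by linarith, by linarith⟩,
      Realization.coord_eq_zero _ (SubdivRel.start (tgt := tgt) e).adj.ne (edgeMap_add _ _) (by simp) (by simp)⟩
  rcases le_total t (2 / 3) with h' | h'
  · right; left
    rw [arc_of_mem h h']
    have k := edgeMap_coord (SubdivRel.middle (src := src) (tgt := tgt) e).adj
      (s := 3 * t - 1) ⟨by linarith, by linarith⟩
    have k' := edgeMap_add (SubdivRel.middle (src := src) (tgt := tgt) e).adj (3 * t - 1)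
    exact ⟨h, h', by linarith, k⟩
  · right; right
    rw [arc_of_ge h']
    have k := edgeMap_coord (SubdivRel.finish (src := src) (tgt := tgt) e).adj
      (s := 3 * t - 2) ⟨by linarith, by linarith⟩
    have k' := edgeMap_add (SubdivRel.finish (src := src) (tgt := tgt) e).adj (3 * t - 2)
    exact ⟨h', Realization.coord_eq_zero _ (SubdivRel.finish (src := src) e).adj.ne (edgeMap_add _ _) (by simp)
      (by simp), by linarith⟩

theorem arc_coord_of_ne {e e' : E} (hne : e' ≠ e) (b : Bool) (t : ℝ) :
    (arc src tgt e t).coord (Sum.inr (e', b)) = 0 := by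
  unfold arc
  split_ifs
  · exact Realization.coord_eq_zero _ (SubdivRel.start (tgt := tgt) e).adj.ne (edgeMap_add _ _) (by simp)
      (by simp [hne])
  · exact Realization.coord_eq_zero _ (SubdivRel.middle (src := src) (tgt := tgt) e).adj.ne
      (edgeMap_add _ _) (by simp [hne]) (by simp [hne])
  · exact Realization.coord_eq_zero _ (SubdivRel.finish (src := src) e).adj.ne (edgeMap_add _ _) (by simp [hne])
      (by simp)

theorem arc_coord_pos (e : E) {t : ℝ} (ht : t ∈ Ioo (0 : ℝ) 1) :
    0 < (arc src tgt e t).coord (Sum.inr (e, false)) +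
      (arc src tgt e t).coord (Sum.inr (e, true)) := by
  obtain ⟨h0, h1⟩ := ht
  rcases arc_coord (src := src) (tgt := tgt) e ⟨h0.le, h1.le⟩ with
    ⟨-, h2, h3⟩ | ⟨-, -, h2, h3⟩ | ⟨-, h2, h3⟩ <;> rw [h2, h3] <;> linarith

theorem SubdivRel.exists_arc {x y : A ⊕ E × Bool} (h : SubdivRel src tgt x y)
    {p : Realization (threefoldGraph src tgt)} (hp : p.coord x + p.coord y = 1) :
    ∃ e, ∃ t ∈ Icc (0 : ℝ) 1, p = arc src tgt e t := by
  have h0 := p.nonneg y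
  have h1 := p.coord_le_one y
  have heq := (eq_edgeMap h.adj hp).symm
  cases h with
  | start e =>
    refine ⟨e, p.coord (Sum.inr (e, false)) / 3, ⟨by linarith, by linarith⟩, ?_⟩
    rw [arc_of_le (by linarith), mul_div_cancel₀ _ (by norm_num)]
    exact heq
  | middle e =>
    refine ⟨e, (p.coord (Sum.inr (e, true)) + 1) / 3, ⟨by linarith, by linarith⟩, ?_⟩
    rw [arc_of_mem (by linarith) (by linarith), mul_div_cancel₀ _ (by norm_num), add_sub_cancel_right]
    exact heq
  | finish e =>
    refine ⟨e, (p.coord (Sum.inl (tgt e)) + 2) / 3, ⟨by linarith, by linarith⟩, ?_⟩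
    rw [arc_of_ge (by linarith), mul_div_cancel₀ _ (by norm_num), add_sub_cancel_right]
    exact heq

theorem isArcSystem_realization [Fact (threefoldGraph src tgt).Connected] :
    IsArcSystem src tgt (fun a => vertexPt (threefoldGraph src tgt) (Sum.inl a))
      (arc src tgt) where
  cont e := (continuous_arc e).continuousOn
  zero := arc_zero
  one := arc_one
  pt_injective a b hab := by
    by_contra hne
    have h1 := vertexPt_self (G := threefoldGraph src tgt) (Sum.inl a)
    rw [show vertexPt (threefoldGraph src tgt) (Sum.inl a) = vertexPt _ (Sum.inl b) from hab,
      vertexPt_ne (by simpa using hne)] at h1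
    norm_num at h1
  ne_pt e t ht a heq := by
    have := arc_coord_pos (src := src) (tgt := tgt) e ht
    rw [heq, vertexPt_ne (by simp), vertexPt_ne (by simp)] at this
    norm_num at this
  injective e t ht e' t' ht' heq := by
    have hee : e = e' := by
      by_contra hne
      have := arc_coord_pos (src := src) (tgt := tgt) e ht
      rw [heq, arc_coord_of_ne hne, arc_coord_of_ne hne] at this
      norm_num at this
    subst hee
    refine ⟨rfl, ?_⟩
    have k := arc_coord (src := src) (tgt := tgt) e (Ioo_subset_Icc_self ht)
    have k' := arc_coord (src := src) (tgt := tgt) e (Ioo_subset_Icc_self ht')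
    rw [heq] at k
    obtain ⟨a1, a2⟩ := ht
    obtain ⟨b1, b2⟩ := ht'
    rcases k with ⟨_, h2, h3⟩ | ⟨_, _, h2, h3⟩ | ⟨_, h2, h3⟩ <;>
      rcases k' with ⟨_, k2, k3⟩ | ⟨_, _, k2, k3⟩ | ⟨_, k2, k3⟩ <;> linarith
  surjective p := by
    obtain ⟨x, y, rfl | hadj, hs⟩ := p.face
    · have hp := eq_vertexPt p fun w h => hs w h h
      rcases x with a | ⟨e, b⟩
      · exact Or.inl ⟨a, hp⟩
      · right
        -- An inner vertex is an end of the middle third of its arc.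
        refine (SubdivRel.middle e).exists_arc ?_
        cases b <;> simp [hp, vertexPt]
    · right
      have hp := p.coord_add_eq_one hadj.ne hs
      rcases ((SimpleGraph.fromRel_adj _ _ _).1 hadj).2 with h | h
      · exact h.exists_arc hp
      · exact h.exists_arc (by linarith)

end ArcSystem

/-! ### Isomorphic graphs -/

section Iso

variable {V W : Type*} [Fintype V] [Fintype W] {G : SimpleGraph V} {H : SimpleGraph W}

/-- The map of realizations induced by an isomorphism of graphs. -/
def mapIso (φ : G ≃g H) (x : Realization G) : Realization H where
  coord w := x.coord (φ.symm w)
  nonneg w := x.nonneg _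
  sum_eq_one := by rw [← x.sum_eq_one]; exact Equiv.sum_comp φ.symm.toEquiv x.coord
  face := by
    obtain ⟨u, v, h, hx⟩ := x.face
    refine ⟨φ u, φ v, h.imp (congrArg φ) φ.map_adj_iff.2, fun w h1 h2 => hx _ ?_ ?_⟩
    · rintro rfl; simp at h1
    · rintro rfl; simp at h2

theorem OnCommonEdge.mapIso (φ : G ≃g H) {x y : Realization G} (h : OnCommonEdge x y) :
    OnCommonEdge (mapIso φ x) (mapIso φ y) := by
  obtain ⟨u, v, h, hx⟩ := h
  refine ⟨φ u, φ v, h.imp (congrArg φ) φ.map_adj_iff.2, fun w h1 h2 => hx _ ?_ ?_⟩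
  · rintro rfl; simp at h1
  · rintro rfl; simp at h2

theorem dist_coord_mapIso_le (φ : G ≃g H) (x y : Realization G) :
    dist (mapIso φ x).coord (mapIso φ y).coord ≤ dist x.coord y.coord :=
  (dist_pi_le_iff dist_nonneg).2 fun w => dist_le_pi_dist x.coord y.coord (φ.symm w)

theorem dist_mapIso_le [Fact G.Connected] [Fact H.Connected] (φ : G ≃g H) (x y : Realization G) :
    dist (mapIso φ x) (mapIso φ y) ≤ dist x y := by
  refine le_dist_of_forall fun l hl => ?_
  induction hl with
  | refl x => simp
  | cons x y z l h hl ih =>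
    refine (dist_triangle _ (mapIso φ y) _).trans (add_le_add ?_ ih)
    rw [(h.mapIso φ).dist_eq]
    exact dist_coord_mapIso_le φ x y

theorem continuous_mapIso [Fact G.Connected] [Fact H.Connected] (φ : G ≃g H) :
    Continuous (mapIso φ) :=
  (LipschitzWith.of_dist_le_mul (K := 1) fun x y => by
    simpa using dist_mapIso_le φ x y).continuous

/-- Isomorphic graphs have homeomorphic realizations. -/
def homeomorphOfIso [Fact G.Connected] [Fact H.Connected] (φ : G ≃g H) :
    Realization G ≃ₜ Realization H where
  toFun := mapIso φ
  invFun := mapIso φ.symm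
  left_inv x := Realization.ext (funext fun w => congrArg x.coord (φ.symm_apply_apply w))
  right_inv x := Realization.ext (funext fun w => congrArg x.coord (φ.apply_symm_apply w))
  continuous_toFun := continuous_mapIso φ
  continuous_invFun := continuous_mapIso φ.symm

theorem isTopGraph_of_homeomorph [hG : Fact G.Connected] {Y : Type*} [TopologicalSpace Y]
    (f : Y ≃ₜ Realization G) : IsTopGraph Y := by
  let φ := SimpleGraph.Iso.map (Fintype.equivFin V) G
  have : Fact (G.map (Fintype.equivFin V)).Connected := ⟨φ.connected_iff.1 hG.out⟩
  exact ⟨Fintype.card V, _, this, ⟨f.trans (homeomorphOfIso φ)⟩⟩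

end Iso

/-- A connected space with a finite graph structure is a topological graph. -/
theorem IsGraphStructure.isTopGraph {Y : Type*} [TopologicalSpace Y] [ConnectedSpace Y]
    {vs : Set Y} {es : Set (Set Y)} (h : IsGraphStructure vs es) : IsTopGraph Y := by
  have := h.t2
  let _ := h.finite_vertices.fintype
  let _ := h.finite_edges.fintype
  choose γ hc h0 h1 hinj himg using fun e : es => h.param e e.2
  let src : es → vs := fun e => ⟨γ e 0, h0 e⟩
  let tgt : es → vs := fun e => ⟨γ e 1, h1 e⟩
  have hmem : ∀ e : es, ∀ t ∈ Ioo (0 : ℝ) 1, γ e t ∈ (e : Set Y) := fun e t ht => by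
    rw [← himg e]
    exact ⟨t, ht, rfl⟩
  have hsys : IsArcSystem src tgt (fun a : vs => (a : Y)) γ :=
    { cont := hc
      zero := fun _ => rfl
      one := fun _ => rfl
      pt_injective := Subtype.val_injective
      ne_pt := fun e t ht a heq =>
        Set.disjoint_left.1 (h.disjoint_vertices e e.2) a.2 (heq ▸ hmem e t ht)
      injective := by
        intro e t ht e' t' ht' heq
        have hee : e = e' := by
          by_contra hne
          exact Set.disjoint_left.1 (h.disjoint_edges e.2 e'.2 fun h => hne (Subtype.ext h))
            (hmem e t ht) (heq ▸ hmem e' t' ht')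
        subst hee
        exact ⟨rfl, hinj e ht ht' heq⟩
      surjective := by
        intro y
        have hy : y ∈ vs ∪ ⋃₀ es := h.cover ▸ mem_univ y
        rcases hy with hy | ⟨e, he, hy⟩
        · exact Or.inl ⟨⟨y, hy⟩, rfl⟩
        · right
          obtain ⟨t, ht, rfl⟩ := (himg ⟨e, he⟩).symm.subset hy
          exact ⟨⟨e, he⟩, t, Ioo_subset_Icc_self ht, rfl⟩ }
  have : Fact (threefoldGraph src tgt).Connected := ⟨hsys.connected_threefoldGraph⟩
  obtain ⟨f⟩ := hsys.nonempty_homeomorph (isArcSystem_realization (src := src) (tgt := tgt))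
  exact isTopGraph_of_homeomorph f

end FiniteMetricGraph

theorem theorem5p33 {V : Type*} [Fintype V] (G : SimpleGraph V) [Fact G.Connected]
    (ε : ℝ) (hε : 0 < ε) :
    -- the canonical bijection of the quotient with `p_ε(X)` is a homeomorphism
    (∃ Φ : BallQuotient G ε ≃ₜ Set.range (ballMap G ε hε.le),
      ∀ x, (Φ (toQuot G ε x) : TopologicalSpace.NonemptyCompacts (Realization G)) =
        ballMap G ε hε.le x) ∧
    -- the quotient is a graph
    IsTopGraph (BallQuotient G ε) ∧
    -- its vertices are the classes of the vertices of `X_ε`, its edges are the images of the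
    -- edges of `X_ε` on which the balls are not the whole space
    IsGraphStructure (toQuot G ε '' subdivVertices G ε)
      {q | ∃ e ∈ subdivEdges G ε, (∃ x ∈ e, Metric.closedBall x ε ≠ Set.univ) ∧
        q = toQuot G ε '' e} ∧
    -- (a) points of such an edge are identified only through isometric identifications of edges
    (∀ e ∈ subdivEdges G ε, ∀ x (hx : x ∈ e), Metric.closedBall x ε ≠ Set.univ →
      ∀ x', x' ≠ x → (toQuot G ε x' = toQuot G ε x ↔
        ∃ e' ∈ subdivEdges G ε, e' ≠ e ∧ ∃ h : e ≃ᵢ e',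
          (∀ y : e, toQuot G ε (h y) = toQuot G ε y) ∧ x' = h ⟨x, hx⟩)) ∧
    -- (b) a vertex whose ball is not the whole space is identified only with vertices
    (∀ v ∈ subdivVertices G ε, Metric.closedBall v ε ≠ Set.univ →
      ∀ x', toQuot G ε x' = toQuot G ε v → x' ∈ subdivVertices G ε) ∧
    -- (c) an edge with an interior point whose ball is the whole space becomes a vertex
    (∀ e ∈ subdivEdges G ε, ∀ x ∈ e, Metric.closedBall x ε = Set.univ →
      (∀ y ∈ closure e, Metric.closedBall y ε = Set.univ) ∧
      ∃ v ∈ subdivVertices G ε, toQuot G ε '' closure e = {toQuot G ε v}) := by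
  refine ⟨exists_homeomorph_range_ballMap hε.le,
    (isGraphStructure_quotient (G := G) hε.le).isTopGraph, isGraphStructure_quotient hε.le,
    fun e he x hx hB x' hne => ⟨exists_edge_identification hε.le he hx hB hne, ?_⟩,
    fun v hv hB x' => mem_subdivVertices_of_toQuot_eq hε.le hv hB,
    fun e he x hx hB => ⟨fun y => ball_eq_univ_of_mem he hx hB, collapsed_edge he hx hB⟩⟩
  rintro ⟨e', -, -, h, hq, rfl⟩
  exact hq ⟨x, hx⟩
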